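/- **Setting.** Let $n,d\ge 0$ be integers, $\Omega\subset\mathbb R^n$ (with the subspace topology), and let $(\Omega,\mathcal A,\mu)$ be a $\sigma$-finite complete measure space. Let $\mathcal K_{bcs}(\mathbb R^d)$ be the collection of nonempty, closed, bounded, convex sets $S\subset\mathbb R^d$ with $-S=S$, equipped with $S+S'=\{s+s'\}$ and $\lambda S=\{\lambda s\}$ ($\lambda\in\mathbb R$). A function $F:\Omega\to\mathcal K_{bcs}(\mathbb R^d)$ is measurable if $\{x: F(x)\cap U\neq\emptyset\}\in\mathcal A$ for every open $U\subset\mathbb R^d$. It is locally integrably bounded if it is measurable and there is a non-negative $k\in L^1_{loc}(\Omega,\mu)$ with $F(x)\subset\{v:|v|\le k(x)\}$ for a.e. $x$. Let $X$ be the set of all locally integrably bounded $F:\Omega\to\mathcal K_{bcs}(\mathbb R^d)$. A norm function on $\Omega$ is a map $\rho:\Omega\times\mathbb R^d\to[0,\infty)$ such that $\rho_x=\rho(x,\cdot)$ is a norm for every $x$ and $x\mapsto\rho_x(v)$ is measurable for every $v$. For $S\subset\mathbb R^d$ put $\rho_x(S)=\sup_{v\in S}\rho_x(v)$. For $0<p<\infty$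 let $$\|F\|_{L^p_{\mathcal K}(\Omega,\rho)}=\Big(\int_\Omega \rho_x(F(x))^p\,d\mu(x)\Big)^{1/p},$$ and let $L^p_{\mathcal K}(\Omega,\rho)$ be the set of measurable $F:\Omega\to\mathcal K_{bcs}(\mathbb R^d)$ for which this is finite. For $g:\mathbb R^d\to[0,\infty)$ put $g^*(v)=\sup\{|\langle v,w\rangle|: w\in\mathbb R^d,\ g(w)\le1\}$. **Theorem 4.1.** Let $1\le p_0,p_1,q_0,q_1<\infty$, let $\rho_0,\rho_1$ be norm functions on $\Omega$, and let $T:X\to X$ be linear and monotone, that is, for all $F,G\in X$ and $\lambda\in\mathbb R$, $$T(F+G)=TF+TG,\qquad T(\lambda F)=\lambda\,TF\quad\text{a.e.},$$ and $F\subset G$ pointwise on $\Omega$ implies $TF\subset TG$ a.e. Suppose that there are constants $M_0,M_1\ge0$ with $$\|TF\|_{L^{q_0}_{\mathcal K}(\Omega,\rho_0)}\le M_0\|F\|_{L^{p_0}_{\mathcal K}(\Omega,\rho_0)}\quad\text{for all }F\in X\cap L^{p_0}_{\mathcal K}(\Omega,\rho_0),$$ $$\|TF\|_{L^{q_1}_{\mathcal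 K}(\Omega,\rho_1)}\le M_1\|F\|_{L^{p_1}_{\mathcal K}(\Omega,\rho_1)}\quad\text{for all }F\in X\cap L^{p_1}_{\mathcal K}(\Omega,\rho_1).$$ Suppose also that whenever $A\in\mathcal A$, $S\in\mathcal K_{bcs}(\mathbb R^d)$, $\chi_AS\in X$ (where $\chi_AS$ equals $S$ on $A$ and $\{0\}$ off $A$) and both functions $x\mapsto(\rho_i)_x(\chi_A(x)S)$, $i=0,1$, are bounded, then both functions $x\mapsto(\rho_i)_x(T(\chi_AS)(x))$, $i=0,1$, are essentially bounded. Let $0<\theta<1$, let $$\frac1p=\frac{1-\theta}{p_0}+\frac{\theta}{p_1},\qquad \frac1q=\frac{1-\theta}{q_0}+\frac{\theta}{q_1},$$ and let $\rho_x=\big((\rho_0)_x^{1-\theta}(\rho_1)_x^{\theta}\big)^{**}$ be the double dual of the weighted geometric mean of $\rho_0$ and $\rho_1$. Then there is a constant $M_\theta\ge0$, independent of $F$, such that $$\|TF\|_{L^{q}_{\mathcal K}(\Omega,\rho)}\le M_\theta\|F\|_{L^{p}_{\mathcal K}(\Omega,\rho)}$$ for all $F\in X\cap L^p_{\mathcal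 K}(\Omega,\rho)$, in particular for all such simple (finitely valued) functions. Moreover, $T$ extends from $X\cap L^p_{\mathcal K}(\Omega,\rho)$ to a linear, monotone operator (in the same almost-everywhere sense) from $L^p_{\mathcal K}(\Omega,\rho)$ to $L^q_{\mathcal K}(\Omega,\rho)$ that satisfies the same inequality for all $F\in L^p_{\mathcal K}(\Omega,\rho)$; the extension agrees with $T$ a.e. -/

import Mathlib

open MeasureTheory
open scoped Pointwise ENNReal NNReal

namespace ConvexSetValued

/-- `𝒦_bcs(ℝᵈ)`: nonempty, closed, bounded, convex, symmetric subsets of `ℝᵈ`. -/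
structure IsKbcs {d : ℕ} (S : Set (EuclideanSpace ℝ (Fin d))) : Prop where
  nonempty : S.Nonempty
  isClosed : IsClosed S
  isBounded : Bornology.IsBounded S
  convex : Convex ℝ S
  symmetric : -S = S

/-- Measurability of a set-valued function: preimages `{x | F x ∩ U ≠ ∅}` of open sets
are measurable. -/
def SetMeasurable {Ω : Type*} [MeasurableSpace Ω] {d : ℕ}
    (F : Ω → Set (EuclideanSpace ℝ (Fin d))) : Prop :=
  ∀ U : Set (EuclideanSpace ℝ (Fin d)), IsOpen U → MeasurableSet {x | (F x ∩ U).Nonempty}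

/-- Measurable functions `Ω → 𝒦_bcs(ℝᵈ)`. -/
structure IsKbcsFun {Ω : Type*} [MeasurableSpace Ω] {d : ℕ}
    (F : Ω → Set (EuclideanSpace ℝ (Fin d))) : Prop where
  isKbcs : ∀ x, IsKbcs (F x)
  measurable : SetMeasurable F

/-- The set of all locally integrably bounded functions `Ω → 𝒦_bcs(ℝᵈ)`. -/
def LocIntBdd {Ω : Type*} [TopologicalSpace Ω] [MeasurableSpace Ω] (μ : Measure Ω) (d : ℕ) :
    Set (Ω → Set (EuclideanSpace ℝ (Fin d))) :=
  {F | IsKbcsFun F ∧ ∃ k : Ω → ℝ, (∀ x, 0 ≤ k x) ∧ LocallyIntegrable k μ ∧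
    ∀ᵐ x ∂μ, F x ⊆ Metric.closedBall 0 (k x)}

/-- Norm functions on `Ω`: each `ρ x` is a norm on `ℝᵈ`, and `x ↦ ρ x v` is measurable
for every `v`. -/
structure IsNormFunction {Ω : Type*} [MeasurableSpace Ω] {d : ℕ}
    (ρ : Ω → EuclideanSpace ℝ (Fin d) → ℝ) : Prop where
  nonneg : ∀ x v, 0 ≤ ρ x v
  add_le : ∀ x u v, ρ x (u + v) ≤ ρ x u + ρ x v
  smul : ∀ x (a : ℝ) v, ρ x (a • v) = |a| * ρ x v
  eq_zero : ∀ x v, ρ x v = 0 → v = 0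
  measurable : ∀ v, Measurable fun x => ρ x v

/-- `p(S) = sup_{v ∈ S} p(v)`, as an element of `[0, ∞]`. -/
noncomputable def supOn {d : ℕ} (p : EuclideanSpace ℝ (Fin d) → ℝ)
    (S : Set (EuclideanSpace ℝ (Fin d))) : ℝ≥0∞ :=
  ⨆ v ∈ S, ENNReal.ofReal (p v)

/-- `‖F‖_{L^p_𝒦(Ω, ρ)} = (∫ ρ_x(F(x))^p dμ(x))^{1/p}` for `0 < p < ∞`, as an element of
`[0, ∞]`. -/
noncomputable def normLpK {Ω : Type*} [MeasurableSpace Ω] {d : ℕ} (μ : Measure Ω) (p : ℝ)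
    (ρ : Ω → EuclideanSpace ℝ (Fin d) → ℝ) (F : Ω → Set (EuclideanSpace ℝ (Fin d))) : ℝ≥0∞ :=
  (∫⁻ x, supOn (ρ x) (F x) ^ p ∂μ) ^ (1 / p)

/-- The space `L^p_𝒦(Ω, ρ)`. -/
def LpK {Ω : Type*} [MeasurableSpace Ω] {d : ℕ} (μ : Measure Ω) (p : ℝ)
    (ρ : Ω → EuclideanSpace ℝ (Fin d) → ℝ) : Set (Ω → Set (EuclideanSpace ℝ (Fin d))) :=
  {F | IsKbcsFun F ∧ normLpK μ p ρ F < ∞}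

/-- The dual `p*(v) = sup {|⟨v, w⟩| : p(w) ≤ 1}`. -/
noncomputable def dual {d : ℕ} (p : EuclideanSpace ℝ (Fin d) → ℝ) :
    EuclideanSpace ℝ (Fin d) → ℝ :=
  fun v => sSup {r : ℝ | ∃ w, p w ≤ 1 ∧ r = |inner ℝ v w|}

/-- The weighted geometric mean `p_θ(v) = p₀(v)^{1-θ} p₁(v)^θ`. -/
noncomputable def geomMean {d : ℕ} (θ : ℝ) (p₀ p₁ : EuclideanSpace ℝ (Fin d) → ℝ) :
    EuclideanSpace ℝ (Fin d) → ℝ :=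
  fun v => p₀ v ^ (1 - θ) * p₁ v ^ θ

/-- `ρ_θ**`, the pointwise double dual of the weighted geometric mean of `ρ₀` and `ρ₁`. -/
noncomputable def interpNorm {Ω : Type*} {d : ℕ} (θ : ℝ)
    (ρ₀ ρ₁ : Ω → EuclideanSpace ℝ (Fin d) → ℝ) : Ω → EuclideanSpace ℝ (Fin d) → ℝ :=
  fun x => dual (dual (geomMean θ (ρ₀ x) (ρ₁ x)))

/-- `T` is linear and monotone on the class `D` of set-valued functions, where the functions
`T F` are only considered up to null sets. -/
structure IsLinearMonotoneOn {Ω : Type*} [MeasurableSpace Ω] {d : ℕ} (μ : Measure Ω)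
    (D : Set (Ω → Set (EuclideanSpace ℝ (Fin d))))
    (T : (Ω → Set (EuclideanSpace ℝ (Fin d))) → Ω → Set (EuclideanSpace ℝ (Fin d))) : Prop where
  map_add : ∀ F ∈ D, ∀ G ∈ D, ∀ᵐ x ∂μ, T (fun y => F y + G y) x = T F x + T G x
  map_smul : ∀ (c : ℝ), ∀ F ∈ D, ∀ᵐ x ∂μ, T (fun y => c • F y) x = c • T F x
  mono : ∀ F ∈ D, ∀ G ∈ D, (∀ x, F x ⊆ G x) → ∀ᵐ x ∂μ, T F x ⊆ T G x

/-- The function `χ_A S`, equal to `S` on `A` and to `{0}` off `A` (for nonempty `S`). -/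
noncomputable def chi {Ω : Type*} {d : ℕ} (A : Set Ω) (S : Set (EuclideanSpace ℝ (Fin d))) :
    Ω → Set (EuclideanSpace ℝ (Fin d)) :=
  fun x => A.indicator (fun _ => (1 : ℝ)) x • S

end ConvexSetValued

open ConvexSetValued

namespace ConvexSetValued

/-! The argument is real interpolation by set inclusions. Write `f x` for the supremum of the
interpolated norm over `F x`, and let `F₀`, `F₁` be the balls of `ρ₀`, `ρ₁` with radii `f ^ (p /
p₀)`, `f ^ (p / p₁)`. By Hahn-Banach separation and the weighted AM-GM inequality, `F ⊆ t ^ θ • F₀ +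
t ^ (θ - 1) • F₁` for every `t > 0` (`exists_add_of_dual_dual_le`,
`mem_smul_add_smul_of_dual_dual_le`). Linearity and monotonicity carry this to `T F`, `T F₀`, `T
F₁`, simultaneously for all rational `t` off one null set.

Conversely, a vector that splits in this way at every rational scale, with components of norm at
most `A` and `B`, has interpolated norm at most `C * (A ^ (1 - θ) * B ^ θ)`, where `C` depends only
on `d` and `θ` (`exists_isSplittingConst`). This is an induction on dimension: each nonzero subspace
has a rank-one projection contractive for both norms, which reduces one coordinate to a scalar
optimisation in `t`. Hölder's inequality and the two endpoint bounds then give the estimate.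

The balls `F₀`, `F₁` need not be locally integrably bounded, so `F` is first truncated. Passing to
the limit uses order continuity of `T` (`ae_eq_closure_iUnion`), which follows from monotonicity and
homogeneity alone. The extension to all of `L^p` is the closure of the union of `T` along
truncations; order continuity makes it independent of the exhaustion, hence additive and monotone.
-/

/-- Abbreviation for `ℝᵈ` with the Euclidean norm. -/
abbrev Euc (d : ℕ) := EuclideanSpace ℝ (Fin d)

variable {d : ℕ}

/-! ### Norms, gauges and their duals. -/

/-- A norm on `ℝᵈ`, as a function. -/
structure IsNorm (g : Euc d → ℝ) : Prop where
  nonneg : ∀ v, 0 ≤ g v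
  add_le : ∀ u v, g (u + v) ≤ g u + g v
  smul : ∀ (a : ℝ) v, g (a • v) = |a| * g v
  eq_zero : ∀ v, g v = 0 → v = 0

/-- A continuous, absolutely homogeneous function that is positive off the origin. -/
structure IsGauge (g : Euc d → ℝ) : Prop where
  continuous : Continuous g
  smul : ∀ (a : ℝ) v, g (a • v) = |a| * g v
  pos : ∀ v, v ≠ 0 → 0 < g v

lemma IsNorm.convexOn {g : Euc d → ℝ} (h : IsNorm g) : ConvexOn ℝ Set.univ g := by
  refine ⟨convex_univ, fun x _ y _ a b ha hb _ => ?_⟩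
  refine (h.add_le _ _).trans ?_
  rw [h.smul, h.smul, abs_of_nonneg ha, abs_of_nonneg hb]
  simp

lemma IsNorm.continuous {g : Euc d → ℝ} (h : IsNorm g) : Continuous g :=
  continuousOn_univ.1 (h.convexOn.continuousOn isOpen_univ)

lemma IsNorm.isGauge {g : Euc d → ℝ} (h : IsNorm g) : IsGauge g where
  continuous := h.continuous
  smul := h.smul
  pos v hv := (h.nonneg v).lt_of_ne fun h0 => hv (h.eq_zero v h0.symm)

namespace IsGauge

variable {g : Euc d → ℝ}

lemma map_zero (h : IsGauge g) : g 0 = 0 := by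
  simpa using h.smul 0 0

lemma nonneg (h : IsGauge g) (v : Euc d) : 0 ≤ g v := by
  rcases eq_or_ne v 0 with rfl | hv
  · exact h.map_zero.ge
  · exact (h.pos v hv).le

lemma exists_norm_le (h : IsGauge g) : ∃ c : ℝ, 0 < c ∧ ∀ v, ‖v‖ ≤ c * g v := by
  -- The unit sphere is empty exactly when `d = 0`; otherwise `g` attains a positive minimum on it.
  rcases (Metric.sphere (0 : Euc d) 1).eq_empty_or_nonempty with he | hne
  · refine ⟨1, one_pos, fun v => ?_⟩
    rcases eq_or_ne v 0 with rfl | hv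
    · simpa using h.nonneg 0
    · exfalso
      have : (‖v‖⁻¹ • v) ∈ Metric.sphere (0 : Euc d) 1 := by
        simp [norm_smul, norm_ne_zero_iff.2 hv]
      rw [he] at this
      exact this
  · obtain ⟨u, hu, hmin⟩ := (isCompact_sphere (0 : Euc d) 1).exists_isMinOn hne
      h.continuous.continuousOn
    have hu0 : u ≠ 0 := by
      rintro rfl
      simp at hu
    have hp := h.pos u hu0
    refine ⟨(g u)⁻¹, inv_pos.2 hp, fun v => ?_⟩
    rcases eq_or_ne v 0 with rfl | hv
    · simp [h.map_zero]
    · have hv' := norm_pos_iff.2 hv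
      have h1 : (‖v‖⁻¹ • v) ∈ Metric.sphere (0 : Euc d) 1 := by
        simp [norm_smul, hv'.ne']
      have h2 : g u ≤ g (‖v‖⁻¹ • v) := hmin h1
      rw [h.smul, abs_of_pos (inv_pos.2 hv'), inv_mul_eq_div, le_div_iff₀ hv'] at h2
      rw [inv_mul_eq_div, le_div_iff₀ hp]
      linarith

lemma abs_inner_le_dual (h : IsGauge g) (v w : Euc d) : |inner ℝ v w| ≤ dual g v * g w := by
  rcases eq_or_ne w 0 with rfl | hw
  · simp [h.map_zero]
  obtain ⟨c, hc, hcg⟩ := h.exists_norm_le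
  have hgw := h.pos w hw
  -- Boundedness is needed because `sSup` of an unbounded set of reals is `0`.
  have hbdd : BddAbove {r : ℝ | ∃ w, g w ≤ 1 ∧ r = |inner ℝ v w|} := by
    refine ⟨‖v‖ * c, ?_⟩
    rintro r ⟨u, hu, rfl⟩
    refine (abs_real_inner_le_norm v u).trans ?_
    gcongr
    refine (hcg u).trans ?_
    nlinarith
  have hmem : |inner ℝ v ((g w)⁻¹ • w)| ≤ dual g v := by
    refine le_csSup hbdd ⟨_, ?_, rfl⟩
    rw [h.smul, abs_of_pos (inv_pos.2 hgw), inv_mul_cancel₀ hgw.ne']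
  rw [real_inner_smul_right, abs_mul, abs_of_pos (inv_pos.2 hgw), inv_mul_eq_div,
    div_le_iff₀ hgw] at hmem
  exact hmem

lemma dual_le (h : IsGauge g) {v : Euc d} {r : ℝ} (hr : 0 ≤ r)
    (H : ∀ w, |inner ℝ v w| ≤ r * g w) : dual g v ≤ r := by
  refine csSup_le ⟨0, 0, by simp [h.map_zero], by simp⟩ ?_
  rintro _ ⟨w, hw, rfl⟩
  refine (H w).trans ?_
  nlinarith

lemma dual_nonneg (v : Euc d) : 0 ≤ dual g v := by
  refine Real.sSup_nonneg ?_
  rintro _ ⟨w, -, rfl⟩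
  exact abs_nonneg _

lemma isNorm_dual (h : IsGauge g) : IsNorm (dual g) := by
  have key : ∀ (a : ℝ) v, dual g (a • v) ≤ |a| * dual g v := fun a v => by
    refine h.dual_le (mul_nonneg (abs_nonneg a) (dual_nonneg v)) fun w => ?_
    rw [real_inner_smul_left, abs_mul, mul_assoc]
    exact mul_le_mul_of_nonneg_left (h.abs_inner_le_dual v w) (abs_nonneg a)
  refine ⟨dual_nonneg, fun u v => ?_, fun a v => le_antisymm (key a v) ?_, fun v hv => ?_⟩
  · refine h.dual_le (add_nonneg (dual_nonneg u) (dual_nonneg v)) fun w => ?_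
    rw [inner_add_left, add_mul]
    exact (abs_add_le _ _).trans (add_le_add (h.abs_inner_le_dual u w) (h.abs_inner_le_dual v w))
  · rcases eq_or_ne a 0 with rfl | ha
    · simpa using dual_nonneg _
    · have := key a⁻¹ (a • v)
      rw [inv_smul_smul₀ ha, abs_inv, inv_mul_eq_div, le_div_iff₀ (abs_pos.2 ha)] at this
      linarith
  · have := h.abs_inner_le_dual v v
    rw [hv, zero_mul] at this
    simpa using abs_nonpos_iff.1 this

lemma dual_dual_le (h : IsGauge g) (v : Euc d) : dual (dual g) v ≤ g v := by
  refine h.isNorm_dual.isGauge.dual_le (h.nonneg v) fun w => ?_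
  rw [real_inner_comm, mul_comm]
  exact h.abs_inner_le_dual w v

/-- The hypothesis says `dual g w ≤ r`, so the bidual satisfies the same linear bounds as `g`. This
is what turns a separating functional controlled by the nonconvex geometric mean into a
contradiction. -/
lemma inner_le_dual_dual (h : IsGauge g) {w : Euc d} {r : ℝ} (hr : 0 ≤ r)
    (H : ∀ u, |inner ℝ w u| ≤ r * g u) (v : Euc d) : inner ℝ w v ≤ r * dual (dual g) v := by
  have h1 := h.isNorm_dual.isGauge.abs_inner_le_dual v w
  rw [real_inner_comm] at h1
  have h2 := h.dual_le hr H
  refine (le_abs_self _).trans (h1.trans ?_)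
  rw [mul_comm]
  exact mul_le_mul_of_nonneg_right h2 (dual_nonneg v)

end IsGauge

lemma isGauge_geomMean {g₀ g₁ : Euc d → ℝ} (h₀ : IsGauge g₀) (h₁ : IsGauge g₁) {θ : ℝ}
    (hθ₀ : 0 < θ) (hθ₁ : θ < 1) : IsGauge (geomMean θ g₀ g₁) where
  continuous := (h₀.continuous.rpow_const fun _ => Or.inr (by linarith)).mul
    (h₁.continuous.rpow_const fun _ => Or.inr hθ₀.le)
  smul a v := by
    have : |a| = |a| ^ (1 - θ) * |a| ^ θ := by
      rcases eq_or_ne a 0 with rfl | ha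
      · simp [hθ₀.ne']
      · rw [← Real.rpow_add (abs_pos.2 ha)]
        simp
    simp only [geomMean]
    rw [h₀.smul, h₁.smul, Real.mul_rpow (abs_nonneg a) (h₀.nonneg v),
      Real.mul_rpow (abs_nonneg a) (h₁.nonneg v)]
    nth_rewrite 3 [this]
    ring
  pos v hv := mul_pos (Real.rpow_pos_of_pos (h₀.pos v hv) _) (Real.rpow_pos_of_pos (h₁.pos v hv) _)

section Measurability

variable {Ω : Type*} [MeasurableSpace Ω]

/-- By continuity in `w`, the condition `dual (g x) v ≤ r` need only be tested on a countable dense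
set. -/
lemma measurable_dual {g : Ω → Euc d → ℝ} (hg : ∀ x, IsGauge (g x))
    (hm : ∀ v, Measurable fun x => g x v) (v : Euc d) : Measurable fun x => dual (g x) v := by
  refine measurable_of_Iic fun r => ?_
  rcases lt_or_ge r 0 with hr | hr
  · convert MeasurableSet.empty (α := Ω)
    ext x
    simpa using hr.trans_le (IsGauge.dual_nonneg v)
  · have : (fun x => dual (g x) v) ⁻¹' Set.Iic r =
        ⋂ i : ℕ, {x | |inner ℝ v (TopologicalSpace.denseSeq (Euc d) i)| ≤
          r * g x (TopologicalSpace.denseSeq (Euc d) i)} := by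
      ext x
      simp only [Set.mem_preimage, Set.mem_Iic, Set.mem_iInter, Set.mem_ofPred_eq]
      constructor
      · intro h i
        exact ((hg x).abs_inner_le_dual _ _).trans
          (mul_le_mul_of_nonneg_right h ((hg x).nonneg _))
      · intro h
        refine (hg x).dual_le hr fun w => ?_
        have hc : IsClosed {w : Euc d | |inner ℝ v w| ≤ r * g x w} :=
          isClosed_le (by fun_prop) (continuous_const.mul (hg x).continuous)
        exact (TopologicalSpace.denseRange_denseSeq (Euc d)).induction_on w hc h
    rw [this]
    exact MeasurableSet.iInter fun i =>
      measurableSet_le measurable_const (measurable_const.mul (hm _))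

lemma IsNormFunction.isNorm {ρ : Ω → Euc d → ℝ} (h : IsNormFunction ρ) (x : Ω) : IsNorm (ρ x) :=
  ⟨h.nonneg x, h.add_le x, h.smul x, h.eq_zero x⟩

lemma IsNormFunction.of_isNorm {ρ : Ω → Euc d → ℝ} (h : ∀ x, IsNorm (ρ x))
    (hm : ∀ v, Measurable fun x => ρ x v) : IsNormFunction ρ :=
  ⟨fun x => (h x).nonneg, fun x => (h x).add_le, fun x => (h x).smul, fun x => (h x).eq_zero, hm⟩

lemma isNormFunction_interpNorm {ρ₀ ρ₁ : Ω → Euc d → ℝ} (h₀ : IsNormFunction ρ₀)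
    (h₁ : IsNormFunction ρ₁) {θ : ℝ} (hθ₀ : 0 < θ) (hθ₁ : θ < 1) :
    IsNormFunction (interpNorm θ ρ₀ ρ₁) := by
  have hg x := isGauge_geomMean (h₀.isNorm x).isGauge (h₁.isNorm x).isGauge hθ₀ hθ₁
  refine .of_isNorm (fun x => (hg x).isNorm_dual.isGauge.isNorm_dual) fun v => ?_
  refine measurable_dual (fun x => (hg x).isNorm_dual.isGauge) (fun w => ?_) v
  exact measurable_dual hg
    (fun w => ((h₀.measurable w).pow_const _).mul ((h₁.measurable w).pow_const _)) w

end Measurability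

/-! ### Splitting a vector of the interpolated ball at every scale. -/

section Interpolation

variable {g₀ g₁ : Euc d → ℝ} {θ : ℝ}

lemma isCompact_setOf_le {g : Euc d → ℝ} (h : IsGauge g) (r : ℝ) : IsCompact {v | g v ≤ r} := by
  obtain ⟨c, hc, hcg⟩ := h.exists_norm_le
  refine (isCompact_closedBall (0 : Euc d) (c * r)).of_isClosed_subset
    (isClosed_le h.continuous continuous_const) fun v hv => ?_
  rw [mem_closedBall_zero_iff]
  exact (hcg v).trans (mul_le_mul_of_nonneg_left hv hc.le)

lemma IsNorm.convex_setOf_le {g : Euc d → ℝ} (h : IsNorm g) (r : ℝ) : Convex ℝ {v | g v ≤ r} := by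
  simpa using h.convexOn.convex_le r

/-- A vector in the unit ball of the interpolated norm splits, at every scale. -/
lemma exists_add_of_dual_dual_le (h₀ : IsNorm g₀) (h₁ : IsNorm g₁) (hθ₀ : 0 < θ) (hθ₁ : θ < 1)
    {v : Euc d} {f s : ℝ} (hs : 0 < s) (hv : dual (dual (geomMean θ g₀ g₁)) v ≤ f) :
    v ∈ {a | g₀ a ≤ s ^ θ * f} + {b | g₁ b ≤ s ^ (θ - 1) * f} := by
  have hg := isGauge_geomMean h₀.isGauge h₁.isGauge hθ₀ hθ₁
  have hf0 : 0 ≤ f := (IsGauge.dual_nonneg v).trans hv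
  have hA : 0 < s ^ θ := Real.rpow_pos_of_pos hs _
  have hB : 0 < s ^ (θ - 1) := Real.rpow_pos_of_pos hs _
  rcases hf0.eq_or_lt with rfl | hf
  · have hv0 : v = 0 := hg.isNorm_dual.isGauge.isNorm_dual.eq_zero v
      (le_antisymm hv (IsGauge.dual_nonneg v))
    refine ⟨0, ?_, 0, ?_, by simp [hv0]⟩
    · simp [h₀.isGauge.map_zero]
    · simp [h₁.isGauge.map_zero]
  by_contra hmem
  obtain ⟨φ, u₀, hu, huv⟩ := geometric_hahn_banach_closed_point
    ((h₀.convex_setOf_le _).add (h₁.convex_setOf_le _))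
    ((isCompact_setOf_le h₀.isGauge _).add (isCompact_setOf_le h₁.isGauge _)).isClosed hmem
  set w := (InnerProductSpace.toDual ℝ (Euc d)).symm φ with hw
  have hφ : ∀ y, φ y = inner ℝ w y := fun y => by
    rw [hw, InnerProductSpace.toDual_symm_apply]
  have hu0 : 0 < u₀ := by
    have := hu 0 ⟨0, by simp [h₀.isGauge.map_zero]; positivity, 0,
      by simp [h₁.isGauge.map_zero]; positivity, by simp⟩
    simpa using this
  have main : ∀ u, |inner ℝ w u| ≤ u₀ / f * geomMean θ g₀ g₁ u := by
    suffices H : ∀ u, inner ℝ w u ≤ u₀ / f * geomMean θ g₀ g₁ u by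
      intro u
      refine abs_le'.2 ⟨H u, ?_⟩
      have := H (-u)
      rw [inner_neg_right] at this
      have h2 := hg.smul (-1) u
      simp only [neg_smul, one_smul, abs_neg, abs_one, one_mul] at h2
      rwa [h2] at this
    intro u
    rcases eq_or_ne u 0 with rfl | hu'
    · simp [hg.map_zero]
    have ha := h₀.isGauge.pos u hu'
    have hb := h₁.isGauge.pos u hu'
    have hgu := hg.pos u hu'
    -- The test point is the longest multiple of `u` in the first ball plus the longest one in the
    -- second.
    have h3 := hu ((s ^ θ * f / g₀ u) • u + (s ^ (θ - 1) * f / g₁ u) • u)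
      ⟨_, by
        simp only [Set.mem_ofPred_eq]
        rw [h₀.smul, abs_of_nonneg (by positivity), div_mul_cancel₀ _ ha.ne'],
       _, by
        simp only [Set.mem_ofPred_eq]
        rw [h₁.smul, abs_of_nonneg (by positivity), div_mul_cancel₀ _ hb.ne'], rfl⟩
    rw [← add_smul, hφ, real_inner_smul_right] at h3
    rcases le_or_gt (inner ℝ w u) 0 with hneg | hpos
    · exact hneg.trans (by positivity)
    -- Weighted AM-GM: the powers of `s` cancel in the geometric mean, and the weights `1 - θ` and
    -- `θ` are then bounded by `1`.
    have h4 : (geomMean θ g₀ g₁ u)⁻¹ ≤ s ^ θ / g₀ u + s ^ (θ - 1) / g₁ u := by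
      have h5 := Real.geom_mean_le_arith_mean2_weighted (w₁ := 1 - θ) (w₂ := θ)
        (p₁ := s ^ θ / g₀ u) (p₂ := s ^ (θ - 1) / g₁ u) (by linarith) hθ₀.le (by positivity)
        (by positivity) (by ring)
      have h6 : (s ^ θ / g₀ u) ^ (1 - θ) * (s ^ (θ - 1) / g₁ u) ^ θ = (geomMean θ g₀ g₁ u)⁻¹ := by
        rw [Real.div_rpow hA.le ha.le, Real.div_rpow hB.le hb.le, ← Real.rpow_mul hs.le,
          ← Real.rpow_mul hs.le, div_mul_div_comm, ← Real.rpow_add hs]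
        have : θ * (1 - θ) + (θ - 1) * θ = 0 := by ring
        rw [this, Real.rpow_zero, one_div]
        rfl
      rw [h6] at h5
      refine h5.trans (add_le_add ?_ ?_)
      · exact mul_le_of_le_one_left (by positivity) (by linarith)
      · exact mul_le_of_le_one_left (by positivity) hθ₁.le
    have h7 : f * (geomMean θ g₀ g₁ u)⁻¹ * inner ℝ w u ≤ u₀ := by
      refine le_trans ?_ h3.le
      refine mul_le_mul_of_nonneg_right ?_ hpos.le
      calc f * (geomMean θ g₀ g₁ u)⁻¹ ≤ f * (s ^ θ / g₀ u + s ^ (θ - 1) / g₁ u) :=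
            mul_le_mul_of_nonneg_left h4 hf.le
        _ = _ := by ring
    rw [div_mul_eq_mul_div, le_div_iff₀ hf]
    rw [mul_right_comm, ← div_eq_mul_inv, div_le_iff₀ hgu] at h7
    linarith
  have h8 := hg.inner_le_dual_dual (by positivity) main v
  rw [← hφ] at h8
  have h9 : u₀ / f * dual (dual (geomMean θ g₀ g₁)) v ≤ u₀ / f * f :=
    mul_le_mul_of_nonneg_left hv (by positivity)
  rw [div_mul_cancel₀ _ hf.ne'] at h9
  linarith

end Interpolation

/-! ### The converse: splitting at all rational scales bounds the interpolated norm. -/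

section Interpolation

variable {g₀ g₁ N : Euc d → ℝ} {θ : ℝ}

/-- At `t = B / A` both terms equal `A ^ (1 - θ) * B ^ θ`. A rational `t` between `B / A` and `2 *
(B / A)` costs at most a factor `2` in the first term and nothing in the second, whence `3`. -/
lemma le_three_mul_of_forall_rat (hθ₀ : 0 < θ) (hθ₁ : θ < 1) {x A B : ℝ} (hA : 0 < A) (hB : 0 < B)
    (H : ∀ t : ℚ, 0 < t → x ≤ (t : ℝ) ^ θ * A + (t : ℝ) ^ (θ - 1) * B) :
    x ≤ 3 * (A ^ (1 - θ) * B ^ θ) := by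
  set τ := B / A with hτ
  have hτ0 : 0 < τ := div_pos hB hA
  obtain ⟨t, ht1, ht2⟩ := exists_rat_btwn (show τ < 2 * τ by linarith)
  have ht0 : (0 : ℝ) < t := hτ0.trans ht1
  have h1 : (t : ℝ) ^ θ ≤ 2 * τ ^ θ := by
    calc (t : ℝ) ^ θ ≤ (2 * τ) ^ θ := Real.rpow_le_rpow ht0.le ht2.le hθ₀.le
      _ = 2 ^ θ * τ ^ θ := Real.mul_rpow (by norm_num) hτ0.le
      _ ≤ 2 * τ ^ θ := by
        gcongr
        simpa using Real.rpow_le_rpow_of_exponent_le (x := 2) (by norm_num) hθ₁.le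
  have h2 : (t : ℝ) ^ (θ - 1) ≤ τ ^ (θ - 1) :=
    Real.rpow_le_rpow_of_nonpos hτ0 ht1.le (by linarith)
  have h3 : τ ^ θ * A = A ^ (1 - θ) * B ^ θ := by
    rw [hτ, Real.div_rpow hB.le hA.le, Real.rpow_sub hA, Real.rpow_one]
    ring
  have h4 : τ ^ (θ - 1) * B = A ^ (1 - θ) * B ^ θ := by
    rw [← h3, Real.rpow_sub hτ0, Real.rpow_one, hτ]
    field_simp
  calc x ≤ (t : ℝ) ^ θ * A + (t : ℝ) ^ (θ - 1) * B := H t (by exact_mod_cast ht0)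
    _ ≤ (2 * τ ^ θ) * A + τ ^ (θ - 1) * B := by gcongr
    _ = 3 * (A ^ (1 - θ) * B ^ θ) := by rw [mul_assoc, h3, h4]; ring

/-- Hahn-Banach, applied to the functional `c • e ↦ c * N e` on the line through `e`. -/
lemma IsNorm.exists_norming (h : IsNorm N) {e : Euc d} (he : e ≠ 0) :
    ∃ φ : Euc d →ₗ[ℝ] ℝ, φ e = N e ∧ ∀ v, |φ v| ≤ N v := by
  have hneg : ∀ v, N (-v) = N v := fun v => by simpa using h.smul (-1) v
  obtain ⟨φ, hφ, hle⟩ := exists_extension_of_le_sublinear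
    (LinearPMap.mkSpanSingleton e (N e) he) N
    (fun c hc x => by rw [h.smul, abs_of_pos hc]) h.add_le (by
      rintro ⟨x, hx⟩
      obtain ⟨c, rfl⟩ := Submodule.mem_span_singleton.1 hx
      have := LinearPMap.mkSpanSingleton'_apply (R := ℝ) e (N e)
        (fun c hc => by simp [(smul_eq_zero.1 hc).resolve_right he]) c hx
      refine (le_of_eq this).trans ?_
      rw [RingHom.id_apply, h.smul, smul_eq_mul]
      exact mul_le_mul_of_nonneg_right (le_abs_self c) (h.nonneg e))
  refine ⟨φ, ?_, fun v => abs_le'.2 ⟨hle v, ?_⟩⟩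
  · have := hφ ⟨e, Submodule.mem_span_singleton_self e⟩
    rw [this]
    exact LinearPMap.mkSpanSingleton_apply _ _ he _
  · simpa [hneg] using hle (-v)

/-- On every nonzero subspace there is a rank-one projection that is contractive in both norms. -/
lemma exists_contractive_projection (h₀ : IsNorm g₀) (h₁ : IsNorm g₁) {W : Submodule ℝ (Euc d)}
    (hW : W ≠ ⊥) : ∃ e ∈ W, e ≠ 0 ∧ ∃ φ : Euc d →ₗ[ℝ] ℝ, φ e = 1 ∧
      ∀ v ∈ W, |φ v| * g₀ e ≤ g₀ v ∧ |φ v| * g₁ e ≤ g₁ v := by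
  obtain ⟨w, hw, hw0⟩ := W.exists_mem_ne_zero_of_ne_bot hW
  have hK : IsCompact ((W : Set (Euc d)) ∩ Metric.sphere 0 1) :=
    (isCompact_sphere _ _).inter_left W.closed_of_finiteDimensional
  have hmem : ∀ v ∈ W, v ≠ 0 → ‖v‖⁻¹ • v ∈ (W : Set (Euc d)) ∩ Metric.sphere 0 1 :=
    fun v hv hv0 => ⟨W.smul_mem _ hv, by simp [norm_smul, norm_ne_zero_iff.2 hv0]⟩
  have hne0 : ∀ v ∈ (W : Set (Euc d)) ∩ Metric.sphere 0 1, v ≠ 0 := by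
    rintro v ⟨-, hv⟩ rfl
    simp at hv
  -- The ratio is homogeneous of degree `0`, so `e` maximises it over all nonzero vectors of `W`.
  -- The projection along a `g₀`-norming functional at `e` is contractive for `g₀`, and maximality
  -- of the ratio transfers this to `g₁` on `W`.
  obtain ⟨e, he, hmax⟩ := hK.exists_isMaxOn (f := fun v => g₀ v / g₁ v) ⟨_, hmem w hw hw0⟩
    (h₀.continuous.continuousOn.div h₁.continuous.continuousOn
      fun v hv => (h₁.isGauge.pos v (hne0 v hv)).ne')
  have he0 := hne0 e he
  have hp0 := h₀.isGauge.pos e he0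
  have hp1 := h₁.isGauge.pos e he0
  obtain ⟨φ, hφe, hφ⟩ := h₀.exists_norming he0
  refine ⟨e, he.1, he0, (g₀ e)⁻¹ • φ, by simp [hφe, hp0.ne'], fun v hv => ?_⟩
  have habs : |((g₀ e)⁻¹ • φ) v| = |φ v| / g₀ e := by
    rw [LinearMap.smul_apply, smul_eq_mul, abs_mul, abs_of_pos (inv_pos.2 hp0), inv_mul_eq_div]
  rw [habs]
  refine ⟨by rw [div_mul_cancel₀ _ hp0.ne']; exact hφ v, ?_⟩
  rcases eq_or_ne v 0 with rfl | hv0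
  · simp [h₁.nonneg 0]
  have h2 : g₀ (‖v‖⁻¹ • v) / g₁ (‖v‖⁻¹ • v) ≤ g₀ e / g₁ e := hmax (hmem v hv hv0)
  have hn : |‖v‖⁻¹| ≠ 0 := by simpa using hv0
  have hpv := h₁.isGauge.pos v hv0
  rw [h₀.smul, h₁.smul, mul_div_mul_left _ _ hn, div_le_div_iff₀ hpv hp1] at h2
  rw [div_mul_eq_mul_div, div_le_iff₀ hp0]
  calc |φ v| * g₁ e ≤ g₀ v * g₁ e := mul_le_mul_of_nonneg_right (hφ v) hp1.le
    _ ≤ _ := by linarith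

/-- Induction on the dimension of `W`. The doubly contractive projection onto `e` splits `v` into a
multiple of `e`, whose coefficient is bounded by the scalar lemma, and a remainder in `W ⊓ ker φ`
that still splits at every scale. The constant precedes the norms so that it serves all points `x`
at once. -/
lemma exists_const_le_geomMean (hθ₀ : 0 < θ) (hθ₁ : θ < 1) (m : ℕ) :
    ∃ C : ℝ, 0 ≤ C ∧ ∀ (g₀ g₁ N : Euc d → ℝ), IsNorm g₀ → IsNorm g₁ → IsNorm N →
      (∀ v, N v ≤ geomMean θ g₀ g₁ v) → ∀ W : Submodule ℝ (Euc d), Module.finrank ℝ W ≤ m →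
      ∀ (A B : ℝ), 0 < A → 0 < B → ∀ v : Euc d,
        (∀ t : ℚ, 0 < t → ∃ a ∈ W, ∃ b ∈ W, g₀ a ≤ A ∧ g₁ b ≤ B ∧
          v = ((t : ℝ) ^ θ) • a + ((t : ℝ) ^ (θ - 1)) • b) →
        N v ≤ C * (A ^ (1 - θ) * B ^ θ) := by
  induction m with
  | zero =>
    refine ⟨0, le_rfl, fun g₀ g₁ N _ _ hN _ W hW A B _ _ v H => ?_⟩
    have hW0 : W = ⊥ := Submodule.finrank_eq_zero.1 (Nat.le_zero.1 hW)
    obtain ⟨a, ha, b, hb, -, -, rfl⟩ := H 1 one_pos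
    rw [hW0, Submodule.mem_bot] at ha hb
    simp [ha, hb, hN.isGauge.map_zero]
  | succ m ih =>
    obtain ⟨C, hC, ih⟩ := ih
    -- The `3` pays for the component along `e`. The complementary projection has norm at most `2`
    -- for both `g₀` and `g₁`, so `A` and `B` double, and so does their geometric mean.
    refine ⟨3 + 2 * C, by positivity, fun g₀ g₁ N h₀ h₁ hN hle W hW A B hA hB v H => ?_⟩
    rcases eq_or_ne W ⊥ with rfl | hbot
    · obtain ⟨a, ha, b, hb, -, -, rfl⟩ := H 1 one_pos
      rw [Submodule.mem_bot] at ha hb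
      simp only [ha, hb, smul_zero, add_zero, hN.isGauge.map_zero]
      positivity
    obtain ⟨e, heW, he0, φ, hφe, hφ⟩ := exists_contractive_projection h₀ h₁ hbot
    have hp0 := h₀.isGauge.pos e he0
    have hp1 := h₁.isGauge.pos e he0
    have hW' : Module.finrank ℝ (W ⊓ LinearMap.ker φ : Submodule ℝ (Euc d)) ≤ m := by
      have : (W ⊓ LinearMap.ker φ : Submodule ℝ (Euc d)) < W := by
        refine lt_of_le_of_ne inf_le_left fun heq => ?_
        have := (heq.ge heW).2
        rw [SetLike.mem_coe, LinearMap.mem_ker, hφe] at this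
        exact one_ne_zero this
      have := Submodule.finrank_lt_finrank_of_lt this
      omega
    have hsub : ∀ {g : Euc d → ℝ}, IsNorm g → ∀ u r, |φ u| * g e ≤ g u → g u ≤ r →
        g (u - φ u • e) ≤ 2 * r := fun {g} hg u r h1 h2 => by
      have h3 := hg.add_le u ((-φ u) • e)
      rw [hg.smul, abs_neg, neg_smul, ← sub_eq_add_neg] at h3
      linarith
    have hmem : ∀ u ∈ W, u - φ u • e ∈ W ⊓ LinearMap.ker φ := fun u hu =>
      ⟨W.sub_mem hu (W.smul_mem _ heW), by simp [hφe]⟩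
    have hrest : N (v - φ v • e) ≤ C * ((2 * A) ^ (1 - θ) * (2 * B) ^ θ) := by
      refine ih g₀ g₁ N h₀ h₁ hN hle _ hW' (2 * A) (2 * B) (by positivity) (by positivity) _
        fun t ht => ?_
      obtain ⟨a, ha, b, hb, haA, hbB, rfl⟩ := H t ht
      refine ⟨_, hmem a ha, _, hmem b hb, hsub h₀ a A (hφ a ha).1 haA,
        hsub h₁ b B (hφ b hb).2 hbB, ?_⟩
      simp only [map_add, map_smul, smul_eq_mul, smul_sub, add_smul, mul_smul]
      abel
    have htwo : (2 * A) ^ (1 - θ) * (2 * B) ^ θ = 2 * (A ^ (1 - θ) * B ^ θ) := by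
      rw [Real.mul_rpow (by norm_num) hA.le, Real.mul_rpow (by norm_num) hB.le,
        mul_mul_mul_comm, ← Real.rpow_add (by norm_num)]
      simp
    have hcoef : |φ v| ≤ 3 * ((A / g₀ e) ^ (1 - θ) * (B / g₁ e) ^ θ) := by
      refine le_three_mul_of_forall_rat hθ₀ hθ₁ (by positivity) (by positivity) fun t ht => ?_
      obtain ⟨a, ha, b, hb, haA, hbB, rfl⟩ := H t ht
      have ht0 : (0 : ℝ) < t := by exact_mod_cast ht
      have hta : 0 < (t : ℝ) ^ θ := Real.rpow_pos_of_pos ht0 _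
      have htb : 0 < (t : ℝ) ^ (θ - 1) := Real.rpow_pos_of_pos ht0 _
      rw [map_add, map_smul, map_smul, smul_eq_mul, smul_eq_mul]
      refine (abs_add_le _ _).trans ?_
      rw [abs_mul, abs_mul, abs_of_pos hta, abs_of_pos htb]
      gcongr
      · rw [le_div_iff₀ hp0]
        exact (hφ a ha).1.trans haA
      · rw [le_div_iff₀ hp1]
        exact (hφ b hb).2.trans hbB
    have hproj : N (φ v • e) ≤ 3 * (A ^ (1 - θ) * B ^ θ) := by
      rw [hN.smul]
      calc |φ v| * N e ≤ 3 * ((A / g₀ e) ^ (1 - θ) * (B / g₁ e) ^ θ) * geomMean θ g₀ g₁ e :=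
            mul_le_mul hcoef (hle e) (hN.nonneg e) (by positivity)
        _ = 3 * (A ^ (1 - θ) * B ^ θ) := by
            have q0 := Real.rpow_pos_of_pos hp0 (1 - θ)
            have q1 := Real.rpow_pos_of_pos hp1 θ
            rw [Real.div_rpow hA.le hp0.le, Real.div_rpow hB.le hp1.le, geomMean]
            field_simp
    have := hN.add_le (v - φ v • e) (φ v • e)
    rw [sub_add_cancel] at this
    rw [htwo] at hrest
    linarith

/-- `C` bounds the interpolated norm of every vector that splits at every rational scale,
uniformly over all pairs of norms on `ℝᵈ`. -/
def IsSplittingConst (d : ℕ) (θ : ℝ) (C : ℝ≥0) : Prop :=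
  ∀ (g₀ g₁ : Euc d → ℝ), IsNorm g₀ → IsNorm g₁ → ∀ (A B : ℝ), 0 ≤ A → 0 ≤ B →
    ∀ v : Euc d, (∀ t : ℚ, 0 < t → v ∈ (((t : ℝ) ^ θ) • {a | g₀ a ≤ A} : Set (Euc d)) +
      (((t : ℝ) ^ (θ - 1)) • {b | g₁ b ≤ B} : Set (Euc d))) →
      dual (dual (geomMean θ g₀ g₁)) v ≤ C * (A ^ (1 - θ) * B ^ θ)

lemma exists_isSplittingConst (d : ℕ) (hθ₀ : 0 < θ) (hθ₁ : θ < 1) :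
    ∃ C : ℝ≥0, IsSplittingConst d θ C := by
  obtain ⟨C, hC, H⟩ := exists_const_le_geomMean (d := d) hθ₀ hθ₁
    (Module.finrank ℝ (⊤ : Submodule ℝ (Euc d)))
  refine ⟨⟨C, hC⟩, fun g₀ g₁ h₀ h₁ A B hA hB v hv => ?_⟩
  have hg := isGauge_geomMean h₀.isGauge h₁.isGauge hθ₀ hθ₁
  -- The radii `A` and `B` may vanish, so they are enlarged by `ε`, which then tends to `0`.
  have key : ∀ ε : ℝ, 0 < ε →
      dual (dual (geomMean θ g₀ g₁)) v ≤ C * ((A + ε) ^ (1 - θ) * (B + ε) ^ θ) := fun ε hε => by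
    refine H g₀ g₁ _ h₀ h₁ hg.isNorm_dual.isGauge.isNorm_dual hg.dual_dual_le ⊤ le_rfl _ _
      (by positivity) (by positivity) v fun t ht => ?_
    obtain ⟨_, ⟨a, ha, rfl⟩, _, ⟨b, hb, rfl⟩, rfl⟩ := hv t ht
    have ha' : g₀ a ≤ A := ha
    have hb' : g₁ b ≤ B := hb
    exact ⟨a, trivial, b, trivial, by linarith, by linarith, rfl⟩
  have hcont : Continuous fun ε : ℝ => C * ((A + ε) ^ (1 - θ) * (B + ε) ^ θ) :=
    continuous_const.mul (((continuous_const.add continuous_id).rpow_const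
      fun _ => Or.inr (by linarith)).mul ((continuous_const.add continuous_id).rpow_const
      fun _ => Or.inr hθ₀.le))
  have hlim := (hcont.tendsto 0).mono_left (nhdsWithin_le_nhds (s := Set.Ioi 0))
  simp only [add_zero] at hlim
  exact ge_of_tendsto hlim (Filter.eventually_of_mem self_mem_nhdsWithin key)

end Interpolation

/-! ### Algebra of symmetric compact convex sets. -/

namespace IsKbcs

variable {S S' : Set (Euc d)}

lemma isCompact (h : IsKbcs S) : IsCompact S :=
  Metric.isCompact_of_isClosed_isBounded h.isClosed h.isBounded

lemma neg_mem (h : IsKbcs S) {v : Euc d} (hv : v ∈ S) : -v ∈ S := by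
  rw [← h.symmetric]
  simpa using hv

lemma zero_mem (h : IsKbcs S) : (0 : Euc d) ∈ S := by
  obtain ⟨v, hv⟩ := h.nonempty
  have := h.convex hv (h.neg_mem hv) (show (0 : ℝ) ≤ 1 / 2 by norm_num)
    (show (0 : ℝ) ≤ 1 / 2 by norm_num) (by norm_num)
  simpa using this

lemma zero_subset (h : IsKbcs S) : (0 : Set (Euc d)) ⊆ S := by
  simpa using h.zero_mem

lemma zero : IsKbcs (0 : Set (Euc d)) where
  nonempty := ⟨0, rfl⟩
  isClosed := isClosed_singleton
  isBounded := Bornology.isBounded_singleton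
  convex := convex_singleton 0
  symmetric := by simp

lemma add (h : IsKbcs S) (h' : IsKbcs S') : IsKbcs (S + S') where
  nonempty := h.nonempty.add h'.nonempty
  isClosed := (h.isCompact.add h'.isCompact).isClosed
  isBounded := (h.isCompact.add h'.isCompact).isBounded
  convex := h.convex.add h'.convex
  symmetric := by rw [neg_add, h.symmetric, h'.symmetric]

lemma smul (h : IsKbcs S) (c : ℝ) : IsKbcs (c • S) where
  nonempty := h.nonempty.smul_set
  isClosed := (h.isCompact.smul c).isClosed
  isBounded := (h.isCompact.smul c).isBounded
  convex := h.convex.smul c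
  symmetric := by rw [← Set.smul_set_neg, h.symmetric]

lemma smul_subset_smul (h : IsKbcs S) {a b : ℝ} (ha : 0 ≤ a) (hab : a ≤ b) : a • S ⊆ b • S := by
  rintro _ ⟨v, hv, rfl⟩
  rcases (ha.trans hab).eq_or_lt with rfl | hb
  · obtain rfl : a = 0 := le_antisymm hab ha
    exact ⟨v, hv, rfl⟩
  · refine ⟨(a / b) • v, ?_, ?_⟩
    · exact h.convex.smul_mem_of_zero_mem h.zero_mem hv
        ⟨by positivity, (div_le_one hb).2 hab⟩
    · simp only [smul_smul]
      rw [mul_div_cancel₀ _ hb.ne']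

lemma subset_add_left (h' : IsKbcs S') : S ⊆ S + S' := fun v hv =>
  ⟨v, hv, 0, h'.zero_mem, add_zero v⟩

lemma subset_add_right (h : IsKbcs S) : S' ⊆ S + S' := fun v hv =>
  ⟨0, h.zero_mem, v, hv, zero_add v⟩

end IsKbcs

lemma IsNorm.isKbcs_setOf_le {g : Euc d → ℝ} (h : IsNorm g) {r : ℝ} (hr : 0 ≤ r) :
    IsKbcs {v | g v ≤ r} where
  nonempty := ⟨0, by simpa [h.isGauge.map_zero] using hr⟩
  isClosed := (isCompact_setOf_le h.isGauge r).isClosed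
  isBounded := (isCompact_setOf_le h.isGauge r).isBounded
  convex := h.convex_setOf_le r
  symmetric := by
    ext v
    have : g (-v) = g v := by simpa using h.smul (-1) v
    simp [this]

/-! ### Suprema of gauges over sets. -/

section SupOn

variable {g : Euc d → ℝ} {S S' : Set (Euc d)}

lemma supOn_le_iff {c : ℝ≥0∞} : supOn g S ≤ c ↔ ∀ v ∈ S, ENNReal.ofReal (g v) ≤ c := by
  simp [supOn]

lemma le_supOn {v : Euc d} (hv : v ∈ S) : ENNReal.ofReal (g v) ≤ supOn g S :=
  supOn_le_iff.1 le_rfl v hv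

lemma supOn_mono (h : S ⊆ S') : supOn g S ≤ supOn g S' :=
  supOn_le_iff.2 fun _ hv => le_supOn (h hv)

lemma IsGauge.supOn_zero (h : IsGauge g) : supOn g 0 = 0 :=
  le_antisymm (supOn_le_iff.2 fun v hv => by rw [Set.mem_zero.1 hv, h.map_zero]; simp) zero_le

lemma supOn_setOf_le (r : ℝ) : supOn g {v | g v ≤ r} ≤ ENNReal.ofReal r :=
  supOn_le_iff.2 fun _ hv => ENNReal.ofReal_le_ofReal hv

lemma IsGauge.supOn_lt_top (h : IsGauge g) (hS : Bornology.IsBounded S) : supOn g S < ∞ := by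
  obtain ⟨C, hC⟩ := (hS.isCompact_closure.image h.continuous).bddAbove
  refine (supOn_le_iff.2 fun v hv => ENNReal.ofReal_le_ofReal
    (hC ⟨v, subset_closure hv, rfl⟩)).trans_lt (ENNReal.ofReal_lt_top (r := C))

lemma IsGauge.isBounded_of_supOn_lt_top (h : IsGauge g) (hS : supOn g S < ∞) :
    Bornology.IsBounded S := by
  refine (isCompact_setOf_le h (supOn g S).toReal).isBounded.subset fun v hv => ?_
  exact (ENNReal.ofReal_le_iff_le_toReal hS.ne).1 (le_supOn hv)

lemma le_toReal_supOn (hS : supOn g S ≠ ∞) {v : Euc d} (hv : v ∈ S) : g v ≤ (supOn g S).toReal :=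
  (ENNReal.ofReal_le_iff_le_toReal hS).1 (le_supOn hv)

lemma IsGauge.subset_zero_of_supOn_eq_zero (h : IsGauge g) (hS : supOn g S = 0) : S ⊆ 0 := by
  intro v hv
  have := le_supOn (g := g) hv
  rw [hS, nonpos_iff_eq_zero, ENNReal.ofReal_eq_zero] at this
  by_contra hv0
  exact (h.pos v hv0).not_ge this

lemma supOn_closure_iUnion (hg : Continuous g) (S : ℕ → Set (Euc d)) :
    supOn g (closure (⋃ k, S k)) = ⨆ k, supOn g (S k) := by
  refine le_antisymm (supOn_le_iff.2 fun v hv => ?_)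
    (iSup_le fun k => supOn_mono ((Set.subset_iUnion S k).trans subset_closure))
  have hcl : IsClosed {v | ENNReal.ofReal (g v) ≤ ⨆ k, supOn g (S k)} :=
    isClosed_le (ENNReal.continuous_ofReal.comp hg) continuous_const
  refine closure_minimal (Set.iUnion_subset fun k u hu => ?_) hcl hv
  exact (le_supOn hu).trans (le_iSup (fun k => supOn g (S k)) k)

end SupOn

/-! ### Measurability of set-valued functions. -/

section Measurability

variable {Ω : Type*} [MeasurableSpace Ω] {F G : Ω → Set (Euc d)}

open TopologicalSpace in
-- By continuity of addition, `F x + G x` meets `U` exactly when `F x` and `G x` meet basic open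
-- sets whose sum lies in `U`; there are countably many such pairs.
lemma SetMeasurable.add (hF : SetMeasurable F) (hG : SetMeasurable G) :
    SetMeasurable fun x => F x + G x := by
  intro U hU
  have : {x | ((F x + G x) ∩ U).Nonempty} =
      ⋃ p ∈ {p : Set (Euc d) × Set (Euc d) | (p.1 ∈ countableBasis (Euc d) ∧
        p.2 ∈ countableBasis (Euc d)) ∧ p.1 + p.2 ⊆ U},
        ({x | (F x ∩ p.1).Nonempty} ∩ {x | (G x ∩ p.2).Nonempty}) := by
    ext x
    simp only [Set.mem_iUnion, Set.mem_inter_iff, Set.mem_ofPred_eq, exists_prop, Prod.exists]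
    constructor
    · rintro ⟨_, ⟨a, ha, b, hb, rfl⟩, hab⟩
      have hn : (fun p : Euc d × Euc d => p.1 + p.2) ⁻¹' U ∈ nhds (a, b) :=
        (hU.preimage continuous_add).mem_nhds hab
      rw [nhds_prod_eq] at hn
      obtain ⟨V, hV, V', hV', hVV⟩ := Filter.mem_prod_iff.1 hn
      obtain ⟨B, hB, haB, hBV⟩ := (isBasis_countableBasis (Euc d)).mem_nhds_iff.1 hV
      obtain ⟨B', hB', hbB, hBV'⟩ := (isBasis_countableBasis (Euc d)).mem_nhds_iff.1 hV'
      refine ⟨B, B', ⟨⟨hB, hB'⟩, ?_⟩, ⟨a, ha, haB⟩, ⟨b, hb, hbB⟩⟩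
      rintro _ ⟨y, hy, z, hz, rfl⟩
      exact hVV (Set.mk_mem_prod (hBV hy) (hBV' hz))
    · rintro ⟨B, B', ⟨-, hsub⟩, ⟨a, ha, haB⟩, ⟨b, hb, hbB⟩⟩
      exact ⟨a + b, ⟨a, ha, b, hb, rfl⟩, hsub ⟨a, haB, b, hbB, rfl⟩⟩
  rw [this]
  refine MeasurableSet.biUnion ?_ fun p hp => ?_
  · exact ((countable_countableBasis (Euc d)).prod (countable_countableBasis (Euc d))).mono
      fun p hp => hp.1
  · exact (hF _ (isOpen_of_mem_countableBasis hp.1.1)).inter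
      (hG _ (isOpen_of_mem_countableBasis hp.1.2))

lemma SetMeasurable.const (S : Set (Euc d)) : SetMeasurable fun _ : Ω => S :=
  fun _ _ => MeasurableSet.const _

lemma SetMeasurable.piecewise {A : Set Ω} (hA : MeasurableSet A) (hF : SetMeasurable F)
    (hG : SetMeasurable G) {H : Ω → Set (Euc d)} (h₁ : ∀ x ∈ A, H x = F x)
    (h₂ : ∀ x ∉ A, H x = G x) : SetMeasurable H := by
  intro U hU
  have : {x | (H x ∩ U).Nonempty} =
      (A ∩ {x | (F x ∩ U).Nonempty}) ∪ (Aᶜ ∩ {x | (G x ∩ U).Nonempty}) := by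
    ext x
    by_cases hx : x ∈ A
    · simp [hx, h₁ x hx]
    · simp [hx, h₂ x hx]
  rw [this]
  exact (hA.inter (hF U hU)).union (hA.compl.inter (hG U hU))

lemma SetMeasurable.indicator {A : Set Ω} (hF : SetMeasurable F) (hA : MeasurableSet A) :
    SetMeasurable (A.indicator F) :=
  .piecewise hA hF (.const 0) (fun _ hx => Set.indicator_of_mem hx F)
    fun _ hx => Set.indicator_of_notMem hx F

lemma SetMeasurable.smul (hF : SetMeasurable F) (hne : ∀ x, (F x).Nonempty) (c : ℝ) :
    SetMeasurable fun x => c • F x := by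
  rcases eq_or_ne c 0 with rfl | hc
  · simp only [Set.zero_smul_set (hne _)]
    exact .const 0
  · intro U hU
    have : {x | ((c • F x) ∩ U).Nonempty} = {x | (F x ∩ (fun v => c • v) ⁻¹' U).Nonempty} := by
      ext x
      constructor
      · rintro ⟨_, ⟨v, hv, rfl⟩, hU⟩
        exact ⟨v, hv, hU⟩
      · rintro ⟨v, hv, hU⟩
        exact ⟨_, ⟨v, hv, rfl⟩, hU⟩
    rw [this]
    exact hF _ (hU.preimage (continuous_const_smul c))

lemma SetMeasurable.natCast_smul (hF : SetMeasurable F) (hne : ∀ x, (F x).Nonempty) {N : Ω → ℕ}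
    (hN : Measurable N) : SetMeasurable fun x => (N x : ℝ) • F x := by
  intro U hU
  have : {x | (((N x : ℝ) • F x) ∩ U).Nonempty} =
      ⋃ n : ℕ, (N ⁻¹' {n} ∩ {x | (((n : ℝ) • F x) ∩ U).Nonempty}) := by
    ext x
    simp
  rw [this]
  exact MeasurableSet.iUnion fun n => (hN (measurableSet_singleton n)).inter (hF.smul hne n U hU)

lemma SetMeasurable.closure_iUnion {F : ℕ → Ω → Set (Euc d)} (hF : ∀ k, SetMeasurable (F k)) :
    SetMeasurable fun x => closure (⋃ k, F k x) := by
  intro U hU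
  have : {x | (closure (⋃ k, F k x) ∩ U).Nonempty} = ⋃ k, {x | (F k x ∩ U).Nonempty} := by
    ext x
    simp only [Set.mem_ofPred_eq, Set.mem_iUnion]
    rw [closure_inter_open_nonempty_iff hU, Set.iUnion_inter, Set.nonempty_iUnion]
  rw [this]
  exact MeasurableSet.iUnion fun k => hF k U hU

/-- The ball always contains `0`, which settles `0 ∈ U`. Otherwise a nonzero point of the ball in
`U` can be shrunk slightly to make the inequality strict, an open condition detected by a dense
sequence. -/
lemma IsNormFunction.setMeasurable_setOf_le {ρ : Ω → Euc d → ℝ} (hρ : IsNormFunction ρ)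
    {r : Ω → ℝ} (hr : Measurable r) (hr0 : ∀ x, 0 ≤ r x) :
    SetMeasurable fun x => {v | ρ x v ≤ r x} := by
  intro U hU
  by_cases h0 : (0 : Euc d) ∈ U
  · convert MeasurableSet.univ (α := Ω)
    refine Set.eq_univ_of_forall fun x => ⟨0, ?_, h0⟩
    simpa [(hρ.isNorm x).isGauge.map_zero] using hr0 x
  · have : {x | ({v | ρ x v ≤ r x} ∩ U).Nonempty} =
        ⋃ i ∈ {i : ℕ | TopologicalSpace.denseSeq (Euc d) i ∈ U},
          {x | ρ x (TopologicalSpace.denseSeq (Euc d) i) < r x} := by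
      ext x
      simp only [Set.mem_iUnion, Set.mem_ofPred_eq, exists_prop]
      constructor
      · rintro ⟨v, hv, hvU⟩
        have hv : ρ x v ≤ r x := hv
        have hv0 : v ≠ 0 := by
          rintro rfl
          exact h0 hvU
        have hρv := (hρ.isNorm x).isGauge.pos v hv0
        have hlim : Filter.Tendsto (fun a : ℝ => a • v) (nhdsWithin 1 (Set.Iio 1)) (nhds v) := by
          have : Continuous fun a : ℝ => a • v := by fun_prop
          simpa using (this.tendsto 1).mono_left nhdsWithin_le_nhds
        have hpos : ∀ᶠ a : ℝ in nhdsWithin 1 (Set.Iio 1), 0 < a :=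
          mem_nhdsWithin_of_mem_nhds (lt_mem_nhds one_pos)
        obtain ⟨a, ⟨haU, ha0⟩, ha1⟩ := ((hlim.eventually (hU.mem_nhds hvU)).and hpos).and
          self_mem_nhdsWithin |>.exists
        have hlt : ρ x (a • v) < r x := by
          rw [hρ.smul, abs_of_pos ha0]
          have : a < 1 := ha1
          nlinarith
        have hopen : IsOpen (U ∩ {w | ρ x w < r x}) :=
          hU.inter (isOpen_lt (hρ.isNorm x).continuous continuous_const)
        obtain ⟨i, hi⟩ := (TopologicalSpace.denseRange_denseSeq (Euc d)).exists_mem_open hopen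
          ⟨a • v, haU, hlt⟩
        exact ⟨i, hi⟩
      · rintro ⟨i, hi, hlt⟩
        exact ⟨_, hlt.le, hi⟩
    rw [this]
    exact MeasurableSet.biUnion (Set.to_countable _) fun i _ =>
      measurableSet_lt (hρ.measurable _) hr

/-- The supremum is written over countably many small balls: a ball that meets `F x` contributes the
infimum of `ρ x` over its dense points, the others contribute `0`. Continuity of `ρ x` makes the two
sides agree, with no measurable selection. -/
lemma IsNormFunction.measurable_supOn {ρ : Ω → Euc d → ℝ} (hρ : IsNormFunction ρ)
    (hF : SetMeasurable F) : Measurable fun x => supOn (ρ x) (F x) := by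
  classical
  set D := TopologicalSpace.denseSeq (Euc d) with hD
  have hdense : DenseRange D := TopologicalSpace.denseRange_denseSeq (Euc d)
  have key : (fun x => supOn (ρ x) (F x)) = fun x => ⨆ p : ℕ × ℕ,
      {x | (F x ∩ Metric.ball (D p.1) (1 / ((p.2 : ℝ) + 1))).Nonempty}.indicator
        (fun x => ⨅ i ∈ {i : ℕ | D i ∈ Metric.ball (D p.1) (1 / ((p.2 : ℝ) + 1))},
          ENNReal.ofReal (ρ x (D i))) x := by
    funext x
    have hc : Continuous fun v => ENNReal.ofReal (ρ x v) :=
      ENNReal.continuous_ofReal.comp (hρ.isNorm x).continuous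
    refine le_antisymm (supOn_le_iff.2 fun v hv => le_of_forall_lt fun c hcv => ?_)
      (iSup_le fun p => ?_)
    · obtain ⟨c', hcc', hc'v⟩ := exists_between hcv
      obtain ⟨ε, hε, hball⟩ := Metric.isOpen_iff.1 (isOpen_lt continuous_const hc) v hc'v
      obtain ⟨n, hn⟩ := exists_nat_one_div_lt (half_pos hε)
      obtain ⟨j, hj⟩ := hdense.exists_dist_lt v (Nat.one_div_pos_of_nat (α := ℝ) (n := n))
      refine hcc'.trans_le (le_iSup_of_le (j, n) ?_)
      have hx : x ∈ {x | (F x ∩ Metric.ball (D j) (1 / ((n : ℝ) + 1))).Nonempty} := ⟨v, hv, hj⟩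
      rw [Set.indicator_of_mem hx]
      refine le_iInf₂ fun i hi => le_of_lt (hball ?_)
      have hi : dist (D i) (D j) < 1 / ((n : ℝ) + 1) := hi
      have := dist_triangle_right (D i) v (D j)
      rw [Metric.mem_ball]
      linarith
    · by_cases hx : x ∈ {x | (F x ∩ Metric.ball (D p.1) (1 / ((p.2 : ℝ) + 1))).Nonempty}
      · rw [Set.indicator_of_mem hx]
        obtain ⟨v, hv, hvb⟩ := hx
        refine le_trans ?_ (le_supOn hv)
        refine le_of_forall_gt fun c hcv => ?_
        obtain ⟨i, hi, hi'⟩ := hdense.exists_mem_open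
          (Metric.isOpen_ball.inter (isOpen_lt hc continuous_const)) ⟨v, hvb, hcv⟩
        exact (iInf₂_le i hi).trans_lt hi'
      · rw [Set.indicator_of_notMem hx]
        exact zero_le
  rw [key]
  refine Measurable.iSup fun p => Measurable.indicator ?_ (hF _ Metric.isOpen_ball)
  exact Measurable.biInf _ (Set.to_countable _) fun i _ => (hρ.measurable _).ennreal_ofReal

namespace IsKbcsFun

lemma add (hF : IsKbcsFun F) (hG : IsKbcsFun G) : IsKbcsFun fun x => F x + G x :=
  ⟨fun x => (hF.isKbcs x).add (hG.isKbcs x), hF.measurable.add hG.measurable⟩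

lemma smul (hF : IsKbcsFun F) (c : ℝ) : IsKbcsFun fun x => c • F x :=
  ⟨fun x => (hF.isKbcs x).smul c, hF.measurable.smul (fun x => (hF.isKbcs x).nonempty) c⟩

lemma natCast_smul (hF : IsKbcsFun F) {N : Ω → ℕ} (hN : Measurable N) :
    IsKbcsFun fun x => (N x : ℝ) • F x :=
  ⟨fun x => (hF.isKbcs x).smul _,
    hF.measurable.natCast_smul (fun x => (hF.isKbcs x).nonempty) hN⟩

lemma indicator (hF : IsKbcsFun F) {A : Set Ω} (hA : MeasurableSet A) :
    IsKbcsFun (A.indicator F) := by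
  refine ⟨fun x => ?_, hF.measurable.indicator hA⟩
  by_cases hx : x ∈ A
  · simpa [hx] using hF.isKbcs x
  · simpa [hx] using IsKbcs.zero

lemma indicator_subset (hF : IsKbcsFun F) (A : Set Ω) (x : Ω) : A.indicator F x ⊆ F x := by
  by_cases hx : x ∈ A
  · simp [hx]
  · simpa [hx] using (hF.isKbcs x).zero_mem

lemma indicator_mono (hF : IsKbcsFun F) {A B : Set Ω} (hAB : A ⊆ B) (x : Ω) :
    A.indicator F x ⊆ B.indicator F x := by
  by_cases hx : x ∈ A
  · simp [hx, hAB hx]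
  · by_cases hx' : x ∈ B
    · simpa [hx, hx'] using (hF.isKbcs x).zero_mem
    · simp [hx, hx']

end IsKbcsFun

lemma IsNormFunction.isKbcsFun_setOf_le {ρ : Ω → Euc d → ℝ} (hρ : IsNormFunction ρ)
    {r : Ω → ℝ} (hr : Measurable r) (hr0 : ∀ x, 0 ≤ r x) :
    IsKbcsFun fun x => {v | ρ x v ≤ r x} :=
  ⟨fun x => (hρ.isNorm x).isKbcs_setOf_le (hr0 x), hρ.setMeasurable_setOf_le hr hr0⟩

lemma isNormFunction_norm : IsNormFunction fun (_ : Ω) (v : Euc d) => ‖v‖ where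
  nonneg _ := norm_nonneg
  add_le _ := norm_add_le
  smul _ a v := by rw [norm_smul, Real.norm_eq_abs]
  eq_zero _ _ := norm_eq_zero.1
  measurable _ := measurable_const

/-- The largest Euclidean norm of an element of `S`. -/
noncomputable def radius (S : Set (Euc d)) : ℝ := (supOn (fun v => ‖v‖) S).toReal

lemma isNorm_norm : IsNorm fun v : Euc d => ‖v‖ :=
  (isNormFunction_norm (Ω := Unit)).isNorm ()

lemma radius_nonneg (S : Set (Euc d)) : 0 ≤ radius S := ENNReal.toReal_nonneg

lemma IsKbcs.norm_le_radius {S : Set (Euc d)} (hS : IsKbcs S) {v : Euc d} (hv : v ∈ S) :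
    ‖v‖ ≤ radius S :=
  le_toReal_supOn (g := fun v : Euc d => ‖v‖) (isNorm_norm.isGauge.supOn_lt_top hS.isBounded).ne hv

lemma radius_le {S : Set (Euc d)} {r : ℝ} (hr : 0 ≤ r) (h : ∀ v ∈ S, ‖v‖ ≤ r) : radius S ≤ r :=
  ENNReal.toReal_le_of_le_ofReal hr (supOn_le_iff.2 fun v hv => ENNReal.ofReal_le_ofReal (h v hv))

lemma radius_mono {S S' : Set (Euc d)} (hS' : IsKbcs S') (h : S ⊆ S') : radius S ≤ radius S' :=
  radius_le (radius_nonneg _) fun _ hv => hS'.norm_le_radius (h hv)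

lemma SetMeasurable.measurable_radius (hF : SetMeasurable F) : Measurable fun x => radius (F x) :=
  (isNormFunction_norm.measurable_supOn hF).ennreal_toReal

end Measurability

/-! ### Locally integrably bounded functions. -/

section LocIntBdd

variable {Ω : Type*} [TopologicalSpace Ω] [MeasurableSpace Ω] {μ : Measure Ω}
  {F G : Ω → Set (Euc d)}

lemma locallyIntegrable_radius (hF : F ∈ LocIntBdd μ d) :
    LocallyIntegrable (fun x => radius (F x)) μ := by
  obtain ⟨hF, k, hk0, hk, hFk⟩ := hF
  refine hk.mono hF.measurable.measurable_radius.aestronglyMeasurable ?_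
  filter_upwards [hFk] with x hx
  rw [Real.norm_of_nonneg (radius_nonneg _), Real.norm_of_nonneg (hk0 x)]
  exact radius_le (hk0 x) fun v hv => by simpa using hx hv

lemma mem_locIntBdd (hF : IsKbcsFun F) (h : LocallyIntegrable (fun x => radius (F x)) μ) :
    F ∈ LocIntBdd μ d :=
  ⟨hF, _, fun _ => radius_nonneg _, h, .of_forall fun x v hv => by
    simpa using (hF.isKbcs x).norm_le_radius hv⟩

lemma mem_locIntBdd_of_subset (hF : IsKbcsFun F) (hG : G ∈ LocIntBdd μ d)
    (h : ∀ᵐ x ∂μ, F x ⊆ G x) : F ∈ LocIntBdd μ d := by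
  obtain ⟨-, k, hk0, hk, hGk⟩ := hG
  refine ⟨hF, k, hk0, hk, ?_⟩
  filter_upwards [h, hGk] with x hx hx'
  exact hx.trans hx'

lemma add_mem_locIntBdd (hF : F ∈ LocIntBdd μ d) (hG : G ∈ LocIntBdd μ d) :
    (fun x => F x + G x) ∈ LocIntBdd μ d := by
  obtain ⟨hF, k, hk0, hk, hFk⟩ := hF
  obtain ⟨hG, l, hl0, hl, hGl⟩ := hG
  refine ⟨hF.add hG, fun x => k x + l x, fun x => add_nonneg (hk0 x) (hl0 x), hk.add hl, ?_⟩
  filter_upwards [hFk, hGl] with x hx hx'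
  rintro _ ⟨u, hu, v, hv, rfl⟩
  have h1 : ‖u‖ ≤ k x := by simpa using hx hu
  have h2 : ‖v‖ ≤ l x := by simpa using hx' hv
  simpa using (norm_add_le u v).trans (add_le_add h1 h2)

lemma smul_mem_locIntBdd (hF : F ∈ LocIntBdd μ d) (c : ℝ) :
    (fun x => c • F x) ∈ LocIntBdd μ d := by
  obtain ⟨hF, k, hk0, hk, hFk⟩ := hF
  refine ⟨hF.smul c, fun x => |c| * k x, fun x => mul_nonneg (abs_nonneg c) (hk0 x),
    hk.smul |c|, ?_⟩
  filter_upwards [hFk] with x hx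
  rintro _ ⟨u, hu, rfl⟩
  have h1 : ‖u‖ ≤ k x := by simpa using hx hu
  simpa [norm_smul] using mul_le_mul_of_nonneg_left h1 (abs_nonneg c)

lemma indicator_mem_locIntBdd (hF : F ∈ LocIntBdd μ d) {A : Set Ω} (hA : MeasurableSet A) :
    A.indicator F ∈ LocIntBdd μ d :=
  mem_locIntBdd_of_subset (hF.1.indicator hA) hF (.of_forall (hF.1.indicator_subset A))

lemma indicator_mem_locIntBdd_of_bounded (hF : IsKbcsFun F) {A : Set Ω} (hA : MeasurableSet A)
    (hμ : μ A < ∞) {r : ℝ} (hr : 0 ≤ r) (h : ∀ x ∈ A, radius (F x) ≤ r) :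
    A.indicator F ∈ LocIntBdd μ d := by
  refine ⟨hF.indicator hA, A.indicator fun _ => r, fun x => Set.indicator_nonneg (fun _ _ => hr) x,
    ((integrable_indicator_iff hA).2 (integrableOn_const hμ.ne)).locallyIntegrable,
    .of_forall fun x => ?_⟩
  by_cases hx : x ∈ A
  · intro v hv
    rw [Set.indicator_of_mem hx] at hv ⊢
    simpa using ((hF.isKbcs x).norm_le_radius hv).trans (h x hx)
  · simp [hx]

end LocIntBdd

/-! ### Order continuity of monotone operators. -/

/-- Linear monotone operators on the locally integrably bounded functions that annihilate the
functions vanishing almost everywhere. -/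
structure IsMonotoneOperator {Ω : Type*} [TopologicalSpace Ω] [MeasurableSpace Ω] (μ : Measure Ω)
    (T : (Ω → Set (Euc d)) → Ω → Set (Euc d)) : Prop where
  map_mem : ∀ F ∈ LocIntBdd μ d, T F ∈ LocIntBdd μ d
  linear : IsLinearMonotoneOn μ (LocIntBdd μ d) T
  map_null : ∀ F ∈ LocIntBdd μ d, (∀ᵐ x ∂μ, F x = 0) → ∀ᵐ x ∂μ, T F x = 0

namespace IsMonotoneOperator

variable {Ω : Type*} [TopologicalSpace Ω] [MeasurableSpace Ω] {μ : Measure Ω}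
  {F G : Ω → Set (Euc d)} {T : (Ω → Set (Euc d)) → Ω → Set (Euc d)}

/-- Monotonicity of `T` requires inclusion everywhere. Adding to `G` the restriction of `F` to a
null set achieves this, and `T` annihilates the added term. -/
lemma ae_subset (hT : IsMonotoneOperator μ T) (hF : F ∈ LocIntBdd μ d) (hG : G ∈ LocIntBdd μ d)
    (h : ∀ᵐ x ∂μ, F x ⊆ G x) : ∀ᵐ x ∂μ, T F x ⊆ T G x := by
  obtain ⟨N, hN, hNm, hN0⟩ := exists_measurable_superset_of_null (ae_iff.1 h)
  have hH : N.indicator F ∈ LocIntBdd μ d := indicator_mem_locIntBdd hF hNm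
  have hH0 := hT.map_null _ hH (by
    filter_upwards [compl_mem_ae_iff.2 hN0] with x hx
    exact Set.indicator_of_notMem hx F)
  have hsub := hT.linear.mono F hF _ (add_mem_locIntBdd hG hH) fun x => by
    by_cases hx : x ∈ N
    · rw [Set.indicator_of_mem hx]
      exact (hG.1.isKbcs x).subset_add_right
    · rw [Set.indicator_of_notMem hx, add_zero]
      by_contra hcon
      exact hx (hN hcon)
  filter_upwards [hH0, hsub, hT.linear.map_add G hG _ hH] with x h1 h2 h3
  rw [h3, h1, add_zero] at h2
  exact h2

lemma ae_monotone (hT : IsMonotoneOperator μ T) (hF : IsKbcsFun F) {A : ℕ → Set Ω} (hA : Monotone A)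
    (hAF : ∀ k, (A k).indicator F ∈ LocIntBdd μ d) :
    ∀ᵐ x ∂μ, Monotone fun k => T ((A k).indicator F) x := by
  have : ∀ᵐ x ∂μ, ∀ k, T ((A k).indicator F) x ⊆ T ((A (k + 1)).indicator F) x :=
    ae_all_iff.2 fun k => hT.linear.mono _ (hAF k) _ (hAF (k + 1))
      (hF.indicator_mono (hA k.le_succ))
  filter_upwards [this] with x hx
  exact monotone_nat_of_le_succ hx

/-- A Borel-Cantelli construction: since the integrals of `radius (F x)` over `B n` tend to `0`
locally, a fast subsequence makes the sum of the truncated radii over `B (φ j)` locally integrable,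
and `N` counts how many of these sets contain `x`. -/
lemma exists_integrable_multiplier [SecondCountableTopology Ω] (hF : F ∈ LocIntBdd μ d)
    {B : ℕ → Set Ω} (hB : Antitone B) (hBm : ∀ k, MeasurableSet (B k))
    (hB0 : ∀ᵐ x ∂μ, ∃ k, x ∉ B k) :
    ∃ (φ : ℕ → ℕ) (N : Ω → ℕ), (fun x => (N x : ℝ) • F x) ∈ LocIntBdd μ d ∧
      ∀ᵐ x ∂μ, ∀ m, x ∈ B (φ m) → m ≤ N x := by
  classical
  set k : Ω → ℝ≥0∞ := fun x => ENNReal.ofReal (radius (F x)) with hk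
  have hkm : Measurable k := hF.1.measurable.measurable_radius.ennreal_ofReal
  obtain ⟨u, huo, hu, hui⟩ := (locallyIntegrable_radius hF).exists_nat_integrableOn
  have hfin : ∀ i, ∫⁻ x in u i, k x ∂μ < ∞ := fun i => (hui i).lintegral_lt_top
  have hlim : ∀ i, Filter.Tendsto (fun n => ∫⁻ x in u i, (B n).indicator k x ∂μ) Filter.atTop
      (nhds 0) := fun i => by
    have := tendsto_lintegral_of_dominated_convergence (μ := μ.restrict (u i))
      (F := fun n => (B n).indicator k) (f := fun _ => 0) k (fun n => hkm.indicator (hBm n))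
      (fun n => .of_forall fun x => Set.indicator_le_self _ _ x) (hfin i).ne (by
        filter_upwards [ae_restrict_of_ae hB0] with x hx
        obtain ⟨m, hm⟩ := hx
        refine tendsto_const_nhds.congr' ?_
        filter_upwards [Filter.eventually_ge_atTop m] with n hn
        rw [Set.indicator_of_notMem fun h => hm (hB hn h)])
    simpa using this
  obtain ⟨φ, hφ, hφ'⟩ := Filter.extraction_forall_of_eventually'
    (P := fun j n => ∀ i ≤ j, ∫⁻ x in u i, (B n).indicator k x ∂μ ≤ 2⁻¹ ^ j) fun j => by
      have : ∀ᶠ n in Filter.atTop, ∀ i ∈ Finset.range (j + 1),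
          ∫⁻ x in u i, (B n).indicator k x ∂μ ≤ 2⁻¹ ^ j := by
        refine (Filter.eventually_all_finset _).2 fun i _ => ?_
        exact (hlim i).eventually (ge_mem_nhds (ENNReal.pow_pos (by simp) j))
      obtain ⟨M, hM⟩ := Filter.eventually_atTop.1 this
      exact ⟨M, fun n hn i hi => hM n hn i (Finset.mem_range.2 (by omega))⟩
  -- Removing the null intersection ensures that every `x` leaves some `C j`, so `N` is finite
  -- everywhere.
  set C : ℕ → Set Ω := fun j => B (φ j) \ ⋂ n, B n with hC
  have hCm : ∀ j, MeasurableSet (C j) := fun j => (hBm _).diff (.iInter hBm)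
  have hex : ∀ x, ∃ j, x ∉ C j := fun x => by
    by_contra! hcon
    have := (hcon 0).2
    simp only [Set.mem_iInter, not_forall] at this
    obtain ⟨n, hn⟩ := this
    exact hn (hB (hφ.id_le n) (hcon n).1)
  have hNm : Measurable fun x => Nat.find (hex x) := measurable_find hex fun j => (hCm j).compl
  refine ⟨φ, fun x => Nat.find (hex x), ?_, ?_⟩
  · have hle : ∀ x, (Nat.find (hex x) : ℝ≥0∞) * k x ≤ ∑' j, (B (φ j)).indicator k x := fun x => by
      refine le_trans (le_of_eq ?_) (ENNReal.sum_le_tsum (Finset.range (Nat.find (hex x))))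
      rw [Finset.sum_congr rfl (g := fun _ => k x), Finset.sum_const, Finset.card_range,
        nsmul_eq_mul]
      intro j hj
      have : x ∈ C j := not_not.1 (Nat.find_min (hex x) (Finset.mem_range.1 hj))
      exact Set.indicator_of_mem this.1 k
    have hrad : ∀ x, radius ((Nat.find (hex x) : ℝ) • F x) ≤
        (Nat.find (hex x) : ℝ) * radius (F x) := fun x => by
      refine radius_le (mul_nonneg (Nat.cast_nonneg _) (radius_nonneg _)) ?_
      rintro _ ⟨v, hv, rfl⟩
      simp only [norm_smul, Real.norm_natCast]
      exact mul_le_mul_of_nonneg_left ((hF.1.isKbcs x).norm_le_radius hv) (Nat.cast_nonneg _)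
    have hG := hF.1.natCast_smul hNm
    refine mem_locIntBdd hG fun x => ?_
    obtain ⟨i, hi⟩ := Set.mem_iUnion.1 (hu.ge (Set.mem_univ x))
    refine ⟨u i, (huo i).mem_nhds hi, hG.measurable.measurable_radius.aestronglyMeasurable, ?_⟩
    rw [HasFiniteIntegral]
    calc ∫⁻ x in u i, ‖radius ((Nat.find (hex x) : ℝ) • F x)‖ₑ ∂μ
        ≤ ∫⁻ x in u i, ∑' j, (B (φ j)).indicator k x ∂μ := by
          refine lintegral_mono fun x => le_trans ?_ (hle x)
          rw [Real.enorm_of_nonneg (radius_nonneg _), hk, ← ENNReal.ofReal_natCast,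
            ← ENNReal.ofReal_mul (Nat.cast_nonneg _)]
          exact ENNReal.ofReal_le_ofReal (hrad x)
      _ = ∑' j, ∫⁻ x in u i, (B (φ j)).indicator k x ∂μ :=
          lintegral_tsum fun j => (hkm.indicator (hBm _)).aemeasurable
      -- The subsequence controls the integral over `u i` only for `j ≥ i`; the finitely many
      -- earlier terms are bounded by the full integral.
      _ ≤ ∑' j, ((if j ∈ Finset.range i then ∫⁻ x in u i, k x ∂μ else 0) + 2⁻¹ ^ j) := by
          refine ENNReal.tsum_le_tsum fun j => ?_
          by_cases hj : j < i
          · rw [if_pos (Finset.mem_range.2 hj)]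
            exact le_add_right (lintegral_mono fun x => Set.indicator_le_self _ _ x)
          · exact le_add_left (hφ' j i (not_lt.1 hj))
      _ < ∞ := by
          rw [ENNReal.tsum_add, tsum_eq_sum (s := Finset.range i)
            (fun j hj => if_neg hj), ENNReal.tsum_geometric]
          refine ENNReal.add_lt_top.2 ⟨ENNReal.sum_lt_top.2 fun j hj => ?_, by simp⟩
          rw [if_pos hj]
          exact hfin i
  · filter_upwards [hB0] with x hx m hm
    refine (Nat.le_find_iff _ _).2 fun j hj hxj => hxj ⟨hB (hφ.monotone hj.le) hm, ?_⟩
    obtain ⟨n, hn⟩ := hx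
    exact fun h => hn (Set.mem_iInter.1 h n)

/-- Since `m • F ⊆ N • F` on `B (φ m)`, monotonicity puts `m • T ((B (φ m)).indicator F) x` inside a
bounded set independent of `m`; divide by `m`. -/
lemma ae_exists_subset_closedBall [SecondCountableTopology Ω] (hT : IsMonotoneOperator μ T)
    (hF : F ∈ LocIntBdd μ d) {B : ℕ → Set Ω} (hB : Antitone B) (hBm : ∀ k, MeasurableSet (B k))
    (hB0 : ∀ᵐ x ∂μ, ∃ k, x ∉ B k) :
    ∀ᵐ x ∂μ, ∀ ε > 0, ∃ k, T ((B k).indicator F) x ⊆ Metric.closedBall 0 ε := by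
  obtain ⟨φ, N, hG, hN⟩ := exists_integrable_multiplier hF hB hBm hB0
  have hBF : ∀ m, (B (φ m)).indicator F ∈ LocIntBdd μ d := fun m =>
    indicator_mem_locIntBdd hF (hBm _)
  have h1 : ∀ᵐ x ∂μ, ∀ m : ℕ, (m : ℝ) • T ((B (φ m)).indicator F) x ⊆
      T (fun x => (N x : ℝ) • F x) x := by
    refine ae_all_iff.2 fun m => ?_
    have := hT.ae_subset (smul_mem_locIntBdd (hBF m) m) hG (by
      filter_upwards [hN] with x hx
      by_cases hxB : x ∈ B (φ m)
      · rw [Set.indicator_of_mem hxB]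
        exact (hF.1.isKbcs x).smul_subset_smul (Nat.cast_nonneg _) (Nat.cast_le.2 (hx m hxB))
      · rw [Set.indicator_of_notMem hxB, smul_zero]
        exact (hG.1.isKbcs x).zero_subset)
    filter_upwards [this, hT.linear.map_smul m _ (hBF m)] with x hx hx'
    rwa [hx'] at hx
  filter_upwards [h1] with x hx ε hε
  set R := radius (T (fun x => (N x : ℝ) • F x) x) with hR
  obtain ⟨m, hm⟩ := exists_nat_gt (R / ε)
  rw [div_lt_iff₀ hε] at hm
  refine ⟨φ m, fun v hv => ?_⟩
  have h2 := ((hT.map_mem _ hG).1.isKbcs x).norm_le_radius (hx m ⟨v, hv, rfl⟩)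
  simp only [norm_smul, Real.norm_natCast] at h2
  have hm0 : (0 : ℝ) < m := by
    by_contra hcon
    have : (m : ℝ) = 0 := le_antisymm (not_lt.1 hcon) (Nat.cast_nonneg _)
    rw [this, zero_mul] at hm
    exact hm.not_ge (radius_nonneg _)
  rw [mem_closedBall_zero_iff]
  exact le_of_mul_le_mul_left (h2.trans hm.le) hm0

/-- Order continuity: `T F` is recovered from the restrictions of `F` to an exhaustion. -/
lemma ae_eq_closure_iUnion [SecondCountableTopology Ω] (hT : IsMonotoneOperator μ T)
    (hF : F ∈ LocIntBdd μ d) {A : ℕ → Set Ω} (hA : Monotone A) (hAm : ∀ k, MeasurableSet (A k))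
    (hA1 : ∀ᵐ x ∂μ, ∃ k, x ∈ A k) :
    ∀ᵐ x ∂μ, T F x = closure (⋃ k, T ((A k).indicator F) x) := by
  have hAF : ∀ k, (A k).indicator F ∈ LocIntBdd μ d := fun k => indicator_mem_locIntBdd hF (hAm k)
  have hAF' : ∀ k, (A k)ᶜ.indicator F ∈ LocIntBdd μ d := fun k =>
    indicator_mem_locIntBdd hF (hAm k).compl
  have h1 := hT.ae_exists_subset_closedBall hF (B := fun k => (A k)ᶜ)
    (fun i j hij => Set.compl_subset_compl.2 (hA hij)) (fun k => (hAm k).compl) (by simpa using hA1)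
  -- The second summand is eventually inside any ball around `0`, so each point of `T F x` is
  -- approximated by points of the first.
  have h2 : ∀ᵐ x ∂μ, ∀ k, T F x = T ((A k).indicator F) x + T ((A k)ᶜ.indicator F) x := by
    refine ae_all_iff.2 fun k => ?_
    have := hT.linear.map_add _ (hAF k) _ (hAF' k)
    rwa [show (fun y => (A k).indicator F y + (A k)ᶜ.indicator F y) = F from
      Set.indicator_self_add_compl (A k) F] at this
  filter_upwards [h1, h2] with x h1 h2
  refine subset_antisymm (fun v hv => ?_) ?_
  · refine Metric.mem_closure_iff.2 fun ε hε => ?_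
    obtain ⟨k, hk⟩ := h1 (ε / 2) (half_pos hε)
    rw [h2 k] at hv
    obtain ⟨a, ha, b, hb, rfl⟩ := hv
    refine ⟨a, Set.mem_iUnion.2 ⟨k, ha⟩, ?_⟩
    have := mem_closedBall_zero_iff.1 (hk hb)
    simp only [dist_eq_norm, add_sub_cancel_left]
    linarith
  · refine closure_minimal (Set.iUnion_subset fun k => ?_) ((hT.map_mem F hF).1.isKbcs x).isClosed
    rw [h2 k]
    exact ((hT.map_mem _ (hAF' k)).1.isKbcs x).subset_add_left

end IsMonotoneOperator

lemma IsGauge.mem_smul_setOf_le {g : Euc d → ℝ} (h : IsGauge g) {c r : ℝ} (hc : 0 < c) {v : Euc d}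
    (hv : g v ≤ c * r) : v ∈ c • {u | g u ≤ r} := by
  refine ⟨c⁻¹ • v, ?_, smul_inv_smul₀ hc.ne' v⟩
  rw [Set.mem_ofPred_eq, h.smul, abs_of_pos (inv_pos.2 hc), inv_mul_le_iff₀ hc]
  exact hv

lemma mem_smul_add_smul_of_dual_dual_le {g₀ g₁ : Euc d → ℝ} {θ : ℝ} (h₀ : IsNorm g₀)
    (h₁ : IsNorm g₁) (hθ₀ : 0 < θ) (hθ₁ : θ < 1) {v : Euc d} {f t α β : ℝ} (ht : 0 < t)
    (hαβ : (1 - θ) * α + θ * β = 1) (hv : dual (dual (geomMean θ g₀ g₁)) v ≤ f) :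
    v ∈ (t ^ θ) • {a | g₀ a ≤ f ^ α} + (t ^ (θ - 1)) • {b | g₁ b ≤ f ^ β} := by
  have hf0 : 0 ≤ f := (IsGauge.dual_nonneg v).trans hv
  rcases hf0.eq_or_lt with rfl | hf
  · have hv0 : v = 0 :=
      (isGauge_geomMean h₀.isGauge h₁.isGauge hθ₀ hθ₁).isNorm_dual.isGauge.isNorm_dual.eq_zero v
        (le_antisymm hv (IsGauge.dual_nonneg v))
    rw [hv0]
    exact (((h₀.isKbcs_setOf_le (Real.rpow_nonneg le_rfl α)).smul _).add
      ((h₁.isKbcs_setOf_le (Real.rpow_nonneg le_rfl β)).smul _)).zero_mem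
  -- This scale turns the radii `s ^ θ * f` and `s ^ (θ - 1) * f` into `t ^ θ * f ^ α` and `t ^ (θ -
  -- 1) * f ^ β`, because `(1 - θ) * α + θ * β = 1`.
  · have hs : 0 < t * f ^ (α - β) := mul_pos ht (Real.rpow_pos_of_pos hf _)
    obtain ⟨a, ha, b, hb, rfl⟩ := exists_add_of_dual_dual_le h₀ h₁ hθ₀ hθ₁ hs hv
    have e0 : (t * f ^ (α - β)) ^ θ * f = t ^ θ * f ^ α := by
      rw [Real.mul_rpow ht.le (Real.rpow_nonneg hf0 _), ← Real.rpow_mul hf0, mul_assoc]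
      nth_rewrite 2 [← Real.rpow_one f]
      rw [← Real.rpow_add hf]
      congr 2
      linarith
    have e1 : (t * f ^ (α - β)) ^ (θ - 1) * f = t ^ (θ - 1) * f ^ β := by
      rw [Real.mul_rpow ht.le (Real.rpow_nonneg hf0 _), ← Real.rpow_mul hf0, mul_assoc]
      nth_rewrite 2 [← Real.rpow_one f]
      rw [← Real.rpow_add hf]
      congr 2
      linarith
    rw [Set.mem_ofPred_eq, e0] at ha
    rw [Set.mem_ofPred_eq, e1] at hb
    exact ⟨a, h₀.isGauge.mem_smul_setOf_le (Real.rpow_pos_of_pos ht _) ha,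
      b, h₁.isGauge.mem_smul_setOf_le (Real.rpow_pos_of_pos ht _) hb, rfl⟩

/-! ### Hölder's inequality and the set-valued Lebesgue norms. -/

section Hoelder

variable {Ω : Type*} [MeasurableSpace Ω] {μ : Measure Ω}

lemma lintegral_rpow_le_of_le_geom_mean {H G₀ G₁ : Ω → ℝ≥0∞} {c : ℝ≥0∞} {θ q q₀ q₁ : ℝ}
    (hθ₀ : 0 < θ) (hθ₁ : θ < 1) (hq : 0 < q) (hq₀ : 0 < q₀) (hq₁ : 0 < q₁)
    (hqq : 1 / q = (1 - θ) / q₀ + θ / q₁) (hG₀ : Measurable G₀) (hG₁ : Measurable G₁)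
    (h : ∀ᵐ x ∂μ, H x ≤ c * (G₀ x ^ (1 - θ) * G₁ x ^ θ)) :
    (∫⁻ x, H x ^ q ∂μ) ^ (1 / q) ≤ c * (((∫⁻ x, G₀ x ^ q₀ ∂μ) ^ (1 / q₀)) ^ (1 - θ) *
      ((∫⁻ x, G₁ x ^ q₁ ∂μ) ^ (1 / q₁)) ^ θ) := by
  have hθ' : 0 < 1 - θ := by linarith
  set a := (1 - θ) * q / q₀ with ha
  set b := θ * q / q₁ with hb
  -- The relation for `1 / q` says exactly that `a` and `b` are Hölder weights for `G₀ ^ q₀` and `G₁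
  -- ^ q₁`.
  have hab : a + b = 1 := by
    have : a + b = q * ((1 - θ) / q₀ + θ / q₁) := by rw [ha, hb]; ring
    rw [this, ← hqq]
    field_simp
  have ha0 : 0 ≤ a := by positivity
  have hb0 : 0 ≤ b := by positivity
  have key : ∫⁻ x, H x ^ q ∂μ ≤
      c ^ q * ((∫⁻ x, G₀ x ^ q₀ ∂μ) ^ a * (∫⁻ x, G₁ x ^ q₁ ∂μ) ^ b) := by
    calc ∫⁻ x, H x ^ q ∂μ ≤ ∫⁻ x, c ^ q * ((G₀ x ^ q₀) ^ a * (G₁ x ^ q₁) ^ b) ∂μ := by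
          refine lintegral_mono_ae ?_
          filter_upwards [h] with x hx
          refine (ENNReal.rpow_le_rpow hx hq.le).trans (le_of_eq ?_)
          rw [ENNReal.mul_rpow_of_nonneg _ _ hq.le, ENNReal.mul_rpow_of_nonneg _ _ hq.le,
            ← ENNReal.rpow_mul, ← ENNReal.rpow_mul, ← ENNReal.rpow_mul, ← ENNReal.rpow_mul,
            ha, hb, mul_div_cancel₀ _ hq₀.ne', mul_div_cancel₀ _ hq₁.ne']
      _ = c ^ q * ∫⁻ x, ((G₀ x ^ q₀) ^ a * (G₁ x ^ q₁) ^ b) ∂μ :=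
          lintegral_const_mul _ (by fun_prop)
      _ ≤ _ := by
          gcongr
          exact ENNReal.lintegral_mul_norm_pow_le (by fun_prop) (by fun_prop) ha0 hb0 hab
  refine (ENNReal.rpow_le_rpow key (by positivity)).trans (le_of_eq ?_)
  have hq' : 0 ≤ 1 / q := by positivity
  rw [ENNReal.mul_rpow_of_nonneg _ _ hq', ENNReal.mul_rpow_of_nonneg _ _ hq',
    ← ENNReal.rpow_mul, ← ENNReal.rpow_mul, ← ENNReal.rpow_mul, ← ENNReal.rpow_mul,
    ← ENNReal.rpow_mul]
  congr 2
  · rw [mul_one_div_cancel hq.ne', ENNReal.rpow_one]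
  · congr 1
    rw [ha]
    field_simp
  · congr 1
    rw [hb]
    field_simp

variable {ρ : Ω → Euc d → ℝ} {F G : Ω → Set (Euc d)} {p : ℝ}

lemma normLpK_mono (hp : 0 < p) (h : ∀ᵐ x ∂μ, F x ⊆ G x) : normLpK μ p ρ F ≤ normLpK μ p ρ G := by
  refine ENNReal.rpow_le_rpow (lintegral_mono_ae ?_) (by positivity)
  filter_upwards [h] with x hx
  exact ENNReal.rpow_le_rpow (supOn_mono hx) hp.le

lemma normLpK_eq_zero (hρ : IsNormFunction ρ) (hp : 0 < p) (h : ∀ᵐ x ∂μ, F x = 0) :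
    normLpK μ p ρ F = 0 := by
  have : ∫⁻ x, supOn (ρ x) (F x) ^ p ∂μ = 0 := by
    rw [← lintegral_zero (μ := μ)]
    refine lintegral_congr_ae ?_
    filter_upwards [h] with x hx
    rw [hx, (hρ.isNorm x).isGauge.supOn_zero, ENNReal.zero_rpow_of_pos hp]
  rw [normLpK, this, ENNReal.zero_rpow_of_pos (by positivity)]

lemma ae_eq_zero_of_normLpK_eq_zero (hρ : IsNormFunction ρ) (hp : 0 < p) (hF : IsKbcsFun F)
    (h : normLpK μ p ρ F = 0) : ∀ᵐ x ∂μ, F x = 0 := by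
  rw [normLpK, ENNReal.rpow_eq_zero_iff_of_pos (by positivity),
    lintegral_eq_zero_iff ((hρ.measurable_supOn hF.measurable).pow_const p)] at h
  filter_upwards [h] with x hx
  have hx : supOn (ρ x) (F x) ^ p = 0 := hx
  rw [ENNReal.rpow_eq_zero_iff_of_pos hp] at hx
  exact subset_antisymm ((hρ.isNorm x).isGauge.subset_zero_of_supOn_eq_zero hx)
    (hF.isKbcs x).zero_subset

lemma ae_supOn_lt_top (hρ : IsNormFunction ρ) (hp : 0 < p) (hF : SetMeasurable F)
    (h : normLpK μ p ρ F < ∞) : ∀ᵐ x ∂μ, supOn (ρ x) (F x) < ∞ := by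
  have h' : ∫⁻ x, supOn (ρ x) (F x) ^ p ∂μ < ∞ :=
    (ENNReal.rpow_lt_top_iff_of_pos (by positivity)).1 h
  filter_upwards [ae_lt_top ((hρ.measurable_supOn hF).pow_const p) h'.ne] with x hx
  exact (ENNReal.rpow_lt_top_iff_of_pos hp).1 hx

/-- Monotone convergence: the supremum over the closure of an increasing union is the supremum of
the suprema. Every passage from truncations to the limit uses this. -/
lemma normLpK_closure_iUnion_le (hρ : IsNormFunction ρ) (hp : 0 < p) {H : ℕ → Ω → Set (Euc d)}
    (hH : ∀ k, SetMeasurable (H k)) (hmono : ∀ᵐ x ∂μ, Monotone fun k => H k x)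
    (hF : ∀ᵐ x ∂μ, F x = closure (⋃ k, H k x)) {c : ℝ≥0∞} (hc : ∀ k, normLpK μ p ρ (H k) ≤ c) :
    normLpK μ p ρ F ≤ c := by
  have h1 : ∫⁻ x, supOn (ρ x) (F x) ^ p ∂μ = ⨆ k, ∫⁻ x, supOn (ρ x) (H k x) ^ p ∂μ := by
    rw [← lintegral_iSup' (fun k => ((hρ.measurable_supOn (hH k)).pow_const p).aemeasurable)]
    · refine lintegral_congr_ae ?_
      filter_upwards [hF] with x hx
      rw [hx, supOn_closure_iUnion (hρ.isNorm x).continuous]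
      exact (ENNReal.orderIsoRpow p hp).map_iSup _
    · filter_upwards [hmono] with x hx i j hij
      exact ENNReal.rpow_le_rpow (supOn_mono (hx hij)) hp.le
  have hp' : 0 < 1 / p := by positivity
  rw [normLpK, h1]
  refine ((ENNReal.orderIsoRpow (1 / p) hp').map_iSup _).le.trans (iSup_le hc)

lemma normLpK_setOf_le_rpow_le {ρ₀ : Ω → Euc d → ℝ} {p₀ : ℝ} (hp : 0 < p) (hp₀ : 0 < p₀)
    (hF : ∀ x, supOn (ρ x) (F x) < ∞) :
    normLpK μ p₀ ρ₀ (fun x => {v | ρ₀ x v ≤ (supOn (ρ x) (F x)).toReal ^ (p / p₀)}) ≤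
      (∫⁻ x, supOn (ρ x) (F x) ^ p ∂μ) ^ (1 / p₀) := by
  refine ENNReal.rpow_le_rpow (lintegral_mono fun x => ?_) (by positivity)
  refine (ENNReal.rpow_le_rpow (supOn_setOf_le _) hp₀.le).trans (le_of_eq ?_)
  rw [← ENNReal.ofReal_rpow_of_nonneg ENNReal.toReal_nonneg (by positivity),
    ENNReal.ofReal_toReal (hF x).ne, ← ENNReal.rpow_mul, div_mul_cancel₀ _ hp₀.ne']

end Hoelder

/-! ### The interpolated bound. -/

section Bound

variable {Ω : Type*} [TopologicalSpace Ω] [MeasurableSpace Ω] {μ : Measure Ω}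
  {F : Ω → Set (Euc d)} {T : (Ω → Set (Euc d)) → Ω → Set (Euc d)}
  {ρ₀ ρ₁ : Ω → Euc d → ℝ} {p₀ p₁ q₀ q₁ p q θ : ℝ} {M₀ M₁ : ℝ≥0}

/-- Linear monotone operators that are bounded from `L^p(ρ)` to `L^q(ρ)` annihilate null
functions. -/
lemma isMonotoneOperator_of_bound (hρ₀ : IsNormFunction ρ₀) (hp₀ : 0 < p₀) (hq₀ : 0 < q₀)
    (hTX : ∀ F ∈ LocIntBdd μ d, T F ∈ LocIntBdd μ d)
    (hT : IsLinearMonotoneOn μ (LocIntBdd μ d) T)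
    (hM₀ : ∀ F ∈ LocIntBdd μ d, F ∈ LpK μ p₀ ρ₀ →
      normLpK μ q₀ ρ₀ (T F) ≤ M₀ * normLpK μ p₀ ρ₀ F) : IsMonotoneOperator μ T := by
  refine ⟨hTX, hT, fun F hF h0 => ?_⟩
  have hn := normLpK_eq_zero hρ₀ hp₀ h0
  have := hM₀ F hF ⟨hF.1, by rw [hn]; exact ENNReal.zero_lt_top⟩
  rw [hn, mul_zero, nonpos_iff_eq_zero] at this
  exact ae_eq_zero_of_normLpK_eq_zero hρ₀ hq₀ (hTX F hF).1 this

/-- The interpolated bound for functions whose two extremal majorants belong to the domain. -/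
lemma normLpK_le_of_majorants_mem {C : ℝ≥0} (hC : IsSplittingConst d θ C)
    (hp₀ : 0 < p₀) (hp₁ : 0 < p₁) (hq₀ : 0 < q₀) (hq₁ : 0 < q₁) (hp0 : 0 < p) (hq0 : 0 < q)
    (hρ₀ : IsNormFunction ρ₀) (hρ₁ : IsNormFunction ρ₁) (hT : IsMonotoneOperator μ T)
    (hM₀ : ∀ F ∈ LocIntBdd μ d, F ∈ LpK μ p₀ ρ₀ →
      normLpK μ q₀ ρ₀ (T F) ≤ M₀ * normLpK μ p₀ ρ₀ F)
    (hM₁ : ∀ F ∈ LocIntBdd μ d, F ∈ LpK μ p₁ ρ₁ →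
      normLpK μ q₁ ρ₁ (T F) ≤ M₁ * normLpK μ p₁ ρ₁ F)
    (hθ₀ : 0 < θ) (hθ₁ : θ < 1)
    (hp : 1 / p = (1 - θ) / p₀ + θ / p₁) (hq : 1 / q = (1 - θ) / q₀ + θ / q₁)
    (hF : F ∈ LpK μ p (interpNorm θ ρ₀ ρ₁))
    (hF₀ : (fun x => {v | ρ₀ x v ≤ (supOn (interpNorm θ ρ₀ ρ₁ x) (F x)).toReal ^ (p / p₀)}) ∈
      LocIntBdd μ d)
    (hF₁ : (fun x => {v | ρ₁ x v ≤ (supOn (interpNorm θ ρ₀ ρ₁ x) (F x)).toReal ^ (p / p₁)}) ∈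
      LocIntBdd μ d) :
    normLpK μ q (interpNorm θ ρ₀ ρ₁) (T F) ≤
      (C * (M₀ ^ (1 - θ) * M₁ ^ θ) : ℝ≥0) * normLpK μ p (interpNorm θ ρ₀ ρ₁) F := by
  have hθ' : 0 < 1 - θ := by linarith
  have hρ := isNormFunction_interpNorm hρ₀ hρ₁ hθ₀ hθ₁
  have hfin : ∀ x, supOn (interpNorm θ ρ₀ ρ₁ x) (F x) < ∞ := fun x =>
    (hρ.isNorm x).isGauge.supOn_lt_top (hF.1.isKbcs x).isBounded
  have hI : ∫⁻ x, supOn (interpNorm θ ρ₀ ρ₁ x) (F x) ^ p ∂μ < ∞ :=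
    (ENNReal.rpow_lt_top_iff_of_pos (by positivity)).1 hF.2
  set I := ∫⁻ x, supOn (interpNorm θ ρ₀ ρ₁ x) (F x) ^ p ∂μ with hIdef
  set F₀ : Ω → Set (Euc d) :=
    fun x => {v | ρ₀ x v ≤ (supOn (interpNorm θ ρ₀ ρ₁ x) (F x)).toReal ^ (p / p₀)} with hF₀def
  set F₁ : Ω → Set (Euc d) :=
    fun x => {v | ρ₁ x v ≤ (supOn (interpNorm θ ρ₀ ρ₁ x) (F x)).toReal ^ (p / p₁)} with hF₁def
  have hαβ : (1 - θ) * (p / p₀) + θ * (p / p₁) = 1 := by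
    have : (1 - θ) * (p / p₀) + θ * (p / p₁) = p * ((1 - θ) / p₀ + θ / p₁) := by ring
    rw [this, ← hp]
    field_simp
  have hn₀ : normLpK μ p₀ ρ₀ F₀ ≤ I ^ (1 / p₀) := normLpK_setOf_le_rpow_le hp0 hp₀ hfin
  have hn₁ : normLpK μ p₁ ρ₁ F₁ ≤ I ^ (1 / p₁) := normLpK_setOf_le_rpow_le hp0 hp₁ hfin
  have hF₀L : F₀ ∈ LpK μ p₀ ρ₀ := ⟨hF₀.1, hn₀.trans_lt
    (ENNReal.rpow_lt_top_of_nonneg (by positivity) hI.ne)⟩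
  have hF₁L : F₁ ∈ LpK μ p₁ ρ₁ := ⟨hF₁.1, hn₁.trans_lt
    (ENNReal.rpow_lt_top_of_nonneg (by positivity) hI.ne)⟩
  have hsub : ∀ t : ℝ, 0 < t → ∀ x, F x ⊆ t ^ θ • F₀ x + t ^ (θ - 1) • F₁ x :=
    fun t ht x v hv => mem_smul_add_smul_of_dual_dual_le (hρ₀.isNorm x) (hρ₁.isNorm x) hθ₀ hθ₁ ht
      hαβ (le_toReal_supOn (hfin x).ne hv)
  have hmaj : ∀ t : ℝ, (fun x => t ^ θ • F₀ x + t ^ (θ - 1) • F₁ x) ∈ LocIntBdd μ d :=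
    fun t => add_mem_locIntBdd (smul_mem_locIntBdd hF₀ _) (smul_mem_locIntBdd hF₁ _)
  have hFX : F ∈ LocIntBdd μ d :=
    mem_locIntBdd_of_subset hF.1 (hmaj 1) (.of_forall (hsub 1 one_pos))
  -- Each `t` has its own exceptional null set, so only countably many scales can be used at once.
  have hTsub : ∀ᵐ x ∂μ, ∀ t : ℚ, 0 < t →
      T F x ⊆ (t : ℝ) ^ θ • T F₀ x + (t : ℝ) ^ (θ - 1) • T F₁ x := by
    refine ae_all_iff.2 fun t => ?_
    by_cases ht : 0 < t
    · filter_upwards [hT.linear.mono F hFX _ (hmaj t) (hsub t (by exact_mod_cast ht)),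
        hT.linear.map_add _ (smul_mem_locIntBdd hF₀ _) _ (smul_mem_locIntBdd hF₁ _),
        hT.linear.map_smul ((t : ℝ) ^ θ) F₀ hF₀, hT.linear.map_smul ((t : ℝ) ^ (θ - 1)) F₁ hF₁]
        with x h1 h2 h3 h4 _
      rwa [h2, h3, h4] at h1
    · exact .of_forall fun x h => absurd h ht
  have hT₀ := (hT.map_mem _ hF₀).1
  have hT₁ := (hT.map_mem _ hF₁).1
  have hpt : ∀ᵐ x ∂μ, supOn (interpNorm θ ρ₀ ρ₁ x) (T F x) ≤
      (C : ℝ≥0∞) * (supOn (ρ₀ x) (T F₀ x) ^ (1 - θ) * supOn (ρ₁ x) (T F₁ x) ^ θ) := by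
    filter_upwards [hTsub] with x hx
    have hfin₀ := ((hρ₀.isNorm x).isGauge.supOn_lt_top (hT₀.isKbcs x).isBounded).ne
    have hfin₁ := ((hρ₁.isNorm x).isGauge.supOn_lt_top (hT₁.isKbcs x).isBounded).ne
    refine supOn_le_iff.2 fun v hv => ?_
    have := hC (ρ₀ x) (ρ₁ x) (hρ₀.isNorm x) (hρ₁.isNorm x) _ _ ENNReal.toReal_nonneg
      ENNReal.toReal_nonneg v fun t ht =>
        Set.add_subset_add (Set.smul_set_mono fun a ha => le_toReal_supOn hfin₀ ha)
          (Set.smul_set_mono fun b hb => le_toReal_supOn hfin₁ hb) (hx t ht hv)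
    refine (ENNReal.ofReal_le_ofReal this).trans (le_of_eq ?_)
    rw [ENNReal.ofReal_mul C.coe_nonneg, ENNReal.ofReal_mul (by positivity),
      ← ENNReal.ofReal_rpow_of_nonneg ENNReal.toReal_nonneg hθ'.le,
      ← ENNReal.ofReal_rpow_of_nonneg ENNReal.toReal_nonneg hθ₀.le,
      ENNReal.ofReal_toReal hfin₀, ENNReal.ofReal_toReal hfin₁, ENNReal.ofReal_coe_nnreal]
  have hmain := lintegral_rpow_le_of_le_geom_mean hθ₀ hθ₁ hq0 hq₀ hq₁ hq
    (hρ₀.measurable_supOn hT₀.measurable) (hρ₁.measurable_supOn hT₁.measurable) hpt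
  have hb₀ : normLpK μ q₀ ρ₀ (T F₀) ≤ M₀ * I ^ (1 / p₀) :=
    (hM₀ F₀ hF₀ hF₀L).trans (by gcongr)
  have hb₁ : normLpK μ q₁ ρ₁ (T F₁) ≤ M₁ * I ^ (1 / p₁) :=
    (hM₁ F₁ hF₁ hF₁L).trans (by gcongr)
  calc normLpK μ q (interpNorm θ ρ₀ ρ₁) (T F)
      ≤ C * (normLpK μ q₀ ρ₀ (T F₀) ^ (1 - θ) * normLpK μ q₁ ρ₁ (T F₁) ^ θ) := hmain
    _ ≤ C * ((M₀ * I ^ (1 / p₀)) ^ (1 - θ) * (M₁ * I ^ (1 / p₁)) ^ θ) := by gcongr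
    _ = (C * (M₀ ^ (1 - θ) * M₁ ^ θ) : ℝ≥0) * I ^ (1 / p) := by
      have e : 1 / p = 1 / p₀ * (1 - θ) + 1 / p₁ * θ := by rw [hp]; ring
      rw [ENNReal.mul_rpow_of_nonneg _ _ hθ'.le, ENNReal.mul_rpow_of_nonneg _ _ hθ₀.le,
        ← ENNReal.rpow_mul, ← ENNReal.rpow_mul, e,
        ENNReal.rpow_add_of_nonneg _ _ (by positivity) (by positivity), ENNReal.coe_mul,
        ENNReal.coe_mul, ENNReal.coe_rpow_of_nonneg _ hθ'.le, ENNReal.coe_rpow_of_nonneg _ hθ₀.le]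
      ring

/-- The interpolated bound on the whole domain of the operator. -/
lemma normLpK_le_of_mem_locIntBdd [SecondCountableTopology Ω] [SigmaFinite μ] {C : ℝ≥0} (hC : IsSplittingConst d θ C)
    (hp₀ : 0 < p₀) (hp₁ : 0 < p₁) (hq₀ : 0 < q₀) (hq₁ : 0 < q₁) (hp0 : 0 < p) (hq0 : 0 < q)
    (hρ₀ : IsNormFunction ρ₀) (hρ₁ : IsNormFunction ρ₁) (hT : IsMonotoneOperator μ T)
    (hM₀ : ∀ F ∈ LocIntBdd μ d, F ∈ LpK μ p₀ ρ₀ →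
      normLpK μ q₀ ρ₀ (T F) ≤ M₀ * normLpK μ p₀ ρ₀ F)
    (hM₁ : ∀ F ∈ LocIntBdd μ d, F ∈ LpK μ p₁ ρ₁ →
      normLpK μ q₁ ρ₁ (T F) ≤ M₁ * normLpK μ p₁ ρ₁ F)
    (hθ₀ : 0 < θ) (hθ₁ : θ < 1)
    (hp : 1 / p = (1 - θ) / p₀ + θ / p₁) (hq : 1 / q = (1 - θ) / q₀ + θ / q₁)
    (hFX : F ∈ LocIntBdd μ d) (hF : F ∈ LpK μ p (interpNorm θ ρ₀ ρ₁)) :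
    normLpK μ q (interpNorm θ ρ₀ ρ₁) (T F) ≤
      (C * (M₀ ^ (1 - θ) * M₁ ^ θ) : ℝ≥0) * normLpK μ p (interpNorm θ ρ₀ ρ₁) F := by
  have hρ := isNormFunction_interpNorm hρ₀ hρ₁ hθ₀ hθ₁
  have hball : ∀ {σ : Ω → Euc d → ℝ} {G : Ω → Set (Euc d)} (r : ℝ), IsNormFunction σ →
      IsKbcsFun G → IsKbcsFun fun x =>
        {v | σ x v ≤ (supOn (interpNorm θ ρ₀ ρ₁ x) (G x)).toReal ^ r} := fun r hσ hG =>
    hσ.isKbcsFun_setOf_le ((hρ.measurable_supOn hG.measurable).ennreal_toReal.pow_const r)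
      fun x => Real.rpow_nonneg ENNReal.toReal_nonneg _
  set F₀ : Ω → Set (Euc d) :=
    fun x => {v | ρ₀ x v ≤ (supOn (interpNorm θ ρ₀ ρ₁ x) (F x)).toReal ^ (p / p₀)} with hF₀def
  set F₁ : Ω → Set (Euc d) :=
    fun x => {v | ρ₁ x v ≤ (supOn (interpNorm θ ρ₀ ρ₁ x) (F x)).toReal ^ (p / p₁)} with hF₁def
  have hF₀ : IsKbcsFun F₀ := hball _ hρ₀ hF.1
  have hF₁ : IsKbcsFun F₁ := hball _ hρ₁ hF.1
  -- On `A k` both majorants are bounded and the measure is finite, so restricting `F` to `A k`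
  -- brings its majorants into the domain of `T`.
  set A : ℕ → Set Ω := fun k =>
    spanningSets μ k ∩ ({x | radius (F₀ x) ≤ k} ∩ {x | radius (F₁ x) ≤ k}) with hAdef
  have hAm : ∀ k, MeasurableSet (A k) := fun k => (measurableSet_spanningSets μ k).inter
    ((measurableSet_le hF₀.measurable.measurable_radius measurable_const).inter
      (measurableSet_le hF₁.measurable.measurable_radius measurable_const))
  have hA : Monotone A := fun i j hij x hx => by
    have hij' : (i : ℝ) ≤ j := Nat.cast_le.2 hij
    exact ⟨spanningSets_mono hij hx.1, le_trans hx.2.1 hij', le_trans hx.2.2 hij'⟩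
  have hA1 : ∀ x, ∃ k, x ∈ A k := fun x => by
    obtain ⟨i, hi⟩ := Set.mem_iUnion.1 ((iUnion_spanningSets μ).ge (Set.mem_univ x))
    obtain ⟨a, ha⟩ := exists_nat_ge (radius (F₀ x))
    obtain ⟨b, hb⟩ := exists_nat_ge (radius (F₁ x))
    refine ⟨max i (max a b), spanningSets_mono (le_max_left _ _) hi, ha.trans ?_, hb.trans ?_⟩
    · exact Nat.cast_le.2 ((le_max_left _ _).trans (le_max_right _ _))
    · exact Nat.cast_le.2 ((le_max_right _ _).trans (le_max_right _ _))
  have hμA : ∀ k, μ (A k) < ∞ := fun k =>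
    (measure_mono Set.inter_subset_left).trans_lt (measure_spanningSets_lt_top μ k)
  have hmaj : ∀ {σ : Ω → Euc d → ℝ} {r : ℝ} (k : ℕ), 0 < r → IsNormFunction σ →
      (∀ x ∈ A k, radius {v | σ x v ≤ (supOn (interpNorm θ ρ₀ ρ₁ x) (F x)).toReal ^ r} ≤ k) →
      (fun x => {v | σ x v ≤
        (supOn (interpNorm θ ρ₀ ρ₁ x) ((A k).indicator F x)).toReal ^ r}) ∈ LocIntBdd μ d := by
    intro σ r k hr hσ hrad
    refine mem_locIntBdd_of_subset (hball r hσ (hF.1.indicator (hAm k)))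
      (indicator_mem_locIntBdd_of_bounded (hball r hσ hF.1) (hAm k) (hμA k) (Nat.cast_nonneg k) hrad)
      (.of_forall fun x => ?_)
    by_cases hx : x ∈ A k
    · simp only [Set.indicator_of_mem hx]
      exact subset_rfl
    -- Off `A k` the majorant is a ball of radius `0 ^ r = 0`; this needs `r ≠ 0`.
    · simp only [Set.indicator_of_notMem hx, (hρ.isNorm x).isGauge.supOn_zero,
        ENNReal.toReal_zero, Real.zero_rpow hr.ne']
      intro v hv
      exact hσ.eq_zero x v (le_antisymm hv (hσ.nonneg x v))
  have hle : ∀ k, normLpK μ p (interpNorm θ ρ₀ ρ₁) ((A k).indicator F) ≤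
      normLpK μ p (interpNorm θ ρ₀ ρ₁) F := fun k =>
    normLpK_mono hp0 (.of_forall (hF.1.indicator_subset _))
  have hmem : ∀ k, (A k).indicator F ∈ LocIntBdd μ d := fun k => indicator_mem_locIntBdd hFX (hAm k)
  refine normLpK_closure_iUnion_le hρ hq0 (fun k => (hT.map_mem _ (hmem k)).1.measurable)
    (hT.ae_monotone hF.1 hA hmem) (hT.ae_eq_closure_iUnion hFX hA hAm (.of_forall hA1)) fun k => ?_
  refine (normLpK_le_of_majorants_mem hC hp₀ hp₁ hq₀ hq₁ hp0 hq0 hρ₀ hρ₁ hT hM₀ hM₁ hθ₀ hθ₁ hp hq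
    ⟨hF.1.indicator (hAm k), (hle k).trans_lt hF.2⟩
    (hmaj k (by positivity) hρ₀ fun x hx => hx.2.1)
    (hmaj k (by positivity) hρ₁ fun x hx => hx.2.2)).trans ?_
  gcongr
  exact hle k

end Bound

/-! ### Extension by truncation. -/

lemma isKbcs_closure_iUnion {S : ℕ → Set (Euc d)} (hS : ∀ k, IsKbcs (S k)) (hmono : Monotone S)
    (hb : Bornology.IsBounded (closure (⋃ k, S k))) : IsKbcs (closure (⋃ k, S k)) where
  nonempty := ⟨0, subset_closure (Set.mem_iUnion.2 ⟨0, (hS 0).zero_mem⟩)⟩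
  isClosed := isClosed_closure
  isBounded := hb
  convex := (hmono.directed_le.convex_iUnion fun {k} => (hS k).convex).closure
  symmetric := by
    rw [← Set.image_neg_eq_neg]
    refine ((Homeomorph.neg (Euc d)).image_closure _).trans ?_
    congr 1
    change (fun v => -v) '' _ = _
    rw [Set.image_iUnion]
    exact Set.iUnion_congr fun k => by rw [Set.image_neg_eq_neg, (hS k).symmetric]

/-- Compactness makes the right-hand sum closed; monotonicity brings two points from different
stages to a common one. -/
lemma closure_iUnion_add {S S' : ℕ → Set (Euc d)} (hS : Monotone S) (hS' : Monotone S')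
    (h : IsCompact (closure (⋃ k, S k))) (h' : IsCompact (closure (⋃ k, S' k))) :
    closure (⋃ k, (S k + S' k)) = closure (⋃ k, S k) + closure (⋃ k, S' k) := by
  refine subset_antisymm (closure_minimal (Set.iUnion_subset fun k => ?_) (h.add h').isClosed) ?_
  · exact Set.add_subset_add ((Set.subset_iUnion S k).trans subset_closure)
      ((Set.subset_iUnion S' k).trans subset_closure)
  · rintro _ ⟨a, ha, b, hb, rfl⟩
    refine map_mem_closure₂ continuous_add ha hb fun a ha b hb => ?_
    obtain ⟨i, hi⟩ := Set.mem_iUnion.1 ha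
    obtain ⟨j, hj⟩ := Set.mem_iUnion.1 hb
    exact Set.mem_iUnion.2 ⟨max i j, a, hS (le_max_left i j) hi, b, hS' (le_max_right i j) hj, rfl⟩

section Extension

variable {Ω : Type*} [MeasurableSpace Ω] {μ : Measure Ω}
  {F G : Ω → Set (Euc d)} {T : (Ω → Set (Euc d)) → Ω → Set (Euc d)}

/-- Sets of finite measure on which `F` is bounded. -/
def truncSet (μ : Measure Ω) [SigmaFinite μ] (F : Ω → Set (Euc d)) (k : ℕ) : Set Ω :=
  spanningSets μ k ∩ {x | radius (F x) ≤ k}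

/-- The limit of `T` along the truncations of `F`. -/
def truncLim (μ : Measure Ω) [SigmaFinite μ] (T : (Ω → Set (Euc d)) → Ω → Set (Euc d))
    (F : Ω → Set (Euc d)) (x : Ω) : Set (Euc d) :=
  closure (⋃ k, T ((truncSet μ F k).indicator F) x)

open Classical in
/-- The extension of `T` by truncation. -/
noncomputable def truncExt (μ : Measure Ω) [SigmaFinite μ]
    (T : (Ω → Set (Euc d)) → Ω → Set (Euc d)) (F : Ω → Set (Euc d)) (x : Ω) : Set (Euc d) :=
  -- The default `0` keeps the values admissible at every point; for `F` in `L^p` and a bounded `T`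
  -- it occurs only on a null set.
  if IsKbcs (truncLim μ T F x) then truncLim μ T F x else 0

lemma isKbcs_truncExt [SigmaFinite μ] (x : Ω) : IsKbcs (truncExt μ T F x) := by
  unfold truncExt
  split_ifs with h
  · exact h
  · exact .zero

lemma truncExt_of_isKbcs [SigmaFinite μ] {x : Ω} (h : IsKbcs (truncLim μ T F x)) :
    truncExt μ T F x = truncLim μ T F x := if_pos h

section TruncSet

variable [SigmaFinite μ]

lemma measurableSet_truncSet (hF : IsKbcsFun F) (k : ℕ) : MeasurableSet (truncSet μ F k) :=
  (measurableSet_spanningSets μ k).inter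
    (measurableSet_le hF.measurable.measurable_radius measurable_const)

lemma monotone_truncSet : Monotone (truncSet μ F) := fun i j hij x hx => by
  have hij' : (i : ℝ) ≤ j := Nat.cast_le.2 hij
  exact ⟨spanningSets_mono hij hx.1, le_trans hx.2 hij'⟩

lemma exists_mem_truncSet (x : Ω) : ∃ k, x ∈ truncSet μ F k := by
  obtain ⟨i, hi⟩ := Set.mem_iUnion.1 ((iUnion_spanningSets μ).ge (Set.mem_univ x))
  obtain ⟨a, ha⟩ := exists_nat_ge (radius (F x))
  exact ⟨max i a, spanningSets_mono (le_max_left _ _) hi,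
    ha.trans (Nat.cast_le.2 (le_max_right _ _))⟩

lemma indicator_mem_locIntBdd_of_subset_truncSet [TopologicalSpace Ω] (hF : IsKbcsFun F) {A : Set Ω} {k : ℕ}
    (hA : MeasurableSet A) (hAk : A ⊆ truncSet μ F k) : A.indicator F ∈ LocIntBdd μ d :=
  indicator_mem_locIntBdd_of_bounded hF hA
    ((measure_mono (hAk.trans Set.inter_subset_left)).trans_lt (measure_spanningSets_lt_top μ k))
    (Nat.cast_nonneg k) fun _ hx => (hAk hx).2

end TruncSet

namespace IsMonotoneOperator

variable [TopologicalSpace Ω]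

/-- Order continuity recovers each `T ((B k).indicator F)` from its further restrictions to `A m`,
which are contained in `T ((A m).indicator F)`. Applied in both directions, it shows that the limit
does not depend on the exhaustion. -/
lemma closure_iUnion_subset [SecondCountableTopology Ω] (hT : IsMonotoneOperator μ T)
    (hF : IsKbcsFun F) {A B : ℕ → Set Ω} (hA : Monotone A) (hAm : ∀ k, MeasurableSet (A k)) (hA1 : ∀ x, ∃ k, x ∈ A k)
    (hAF : ∀ k, (A k).indicator F ∈ LocIntBdd μ d) (hBF : ∀ k, (B k).indicator F ∈ LocIntBdd μ d) :
    ∀ᵐ x ∂μ, closure (⋃ k, T ((B k).indicator F) x) ⊆ closure (⋃ k, T ((A k).indicator F) x) := by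
  have h1 : ∀ᵐ x ∂μ, ∀ k, T ((B k).indicator F) x =
      closure (⋃ m, T ((A m).indicator ((B k).indicator F)) x) :=
    ae_all_iff.2 fun k => hT.ae_eq_closure_iUnion (hBF k) hA hAm (.of_forall hA1)
  have h2 : ∀ᵐ x ∂μ, ∀ k m, T ((A m).indicator ((B k).indicator F)) x ⊆
      T ((A m).indicator F) x := by
    refine ae_all_iff.2 fun k => ae_all_iff.2 fun m => hT.linear.mono _
      (indicator_mem_locIntBdd (hBF k) (hAm m)) _ (hAF m) fun x => ?_
    rw [Set.indicator_indicator]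
    exact hF.indicator_mono Set.inter_subset_left x
  filter_upwards [h1, h2] with x h1 h2
  refine closure_minimal (Set.iUnion_subset fun k => ?_) isClosed_closure
  rw [h1 k]
  exact closure_mono (Set.iUnion_mono (h2 k))

variable {ρ : Ω → Euc d → ℝ} {p q : ℝ} {M : ℝ≥0} [SigmaFinite μ]

lemma normLpK_truncLim_le (hT : IsMonotoneOperator μ T) (hρ : IsNormFunction ρ) (hp : 0 < p)
    (hq : 0 < q) (hM : ∀ F ∈ LocIntBdd μ d, F ∈ LpK μ p ρ →
      normLpK μ q ρ (T F) ≤ M * normLpK μ p ρ F) (hF : F ∈ LpK μ p ρ) :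
    normLpK μ q ρ (truncLim μ T F) ≤ M * normLpK μ p ρ F := by
  have hAF : ∀ k, (truncSet μ F k).indicator F ∈ LocIntBdd μ d := fun k =>
    indicator_mem_locIntBdd_of_subset_truncSet hF.1 (measurableSet_truncSet hF.1 k) subset_rfl
  refine normLpK_closure_iUnion_le hρ hq (fun k => (hT.map_mem _ (hAF k)).1.measurable)
    (hT.ae_monotone hF.1 monotone_truncSet hAF) (.of_forall fun x => rfl) fun k => ?_
  have hle : normLpK μ p ρ ((truncSet μ F k).indicator F) ≤ normLpK μ p ρ F :=
    normLpK_mono hp (.of_forall (hF.1.indicator_subset _))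
  refine (hM _ (hAF k) ⟨(hAF k).1, hle.trans_lt hF.2⟩).trans ?_
  gcongr

/-- Only boundedness could fail in the limit, and the finite `L^q` norm forces it almost everywhere.
-/
lemma ae_isKbcs_truncLim (hT : IsMonotoneOperator μ T) (hρ : IsNormFunction ρ) (hp : 0 < p)
    (hq : 0 < q) (hM : ∀ F ∈ LocIntBdd μ d, F ∈ LpK μ p ρ →
      normLpK μ q ρ (T F) ≤ M * normLpK μ p ρ F) (hF : F ∈ LpK μ p ρ) :
    ∀ᵐ x ∂μ, IsKbcs (truncLim μ T F x) := by
  have hAF : ∀ k, (truncSet μ F k).indicator F ∈ LocIntBdd μ d := fun k =>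
    indicator_mem_locIntBdd_of_subset_truncSet hF.1 (measurableSet_truncSet hF.1 k) subset_rfl
  have hlt : normLpK μ q ρ (truncLim μ T F) < ∞ :=
    (hT.normLpK_truncLim_le hρ hp hq hM hF).trans_lt (ENNReal.mul_lt_top ENNReal.coe_lt_top hF.2)
  have hm : SetMeasurable (truncLim μ T F) :=
    .closure_iUnion fun k => (hT.map_mem _ (hAF k)).1.measurable
  filter_upwards [hT.ae_monotone hF.1 monotone_truncSet hAF, ae_supOn_lt_top hρ hq hm hlt]
    with x h1 h2
  exact isKbcs_closure_iUnion (fun k => (hT.map_mem _ (hAF k)).1.isKbcs x) h1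
    ((hρ.isNorm x).isGauge.isBounded_of_supOn_lt_top h2)

lemma ae_truncExt_eq (hT : IsMonotoneOperator μ T) (hρ : IsNormFunction ρ) (hp : 0 < p)
    (hq : 0 < q) (hM : ∀ F ∈ LocIntBdd μ d, F ∈ LpK μ p ρ →
      normLpK μ q ρ (T F) ≤ M * normLpK μ p ρ F) (hF : F ∈ LpK μ p ρ) :
    ∀ᵐ x ∂μ, truncExt μ T F x = truncLim μ T F x := by
  filter_upwards [hT.ae_isKbcs_truncLim hρ hp hq hM hF] with x hx
  exact truncExt_of_isKbcs hx

lemma isKbcsFun_truncExt [μ.IsComplete] (hT : IsMonotoneOperator μ T) (hρ : IsNormFunction ρ)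
    (hp : 0 < p) (hq : 0 < q) (hM : ∀ F ∈ LocIntBdd μ d, F ∈ LpK μ p ρ →
      normLpK μ q ρ (T F) ≤ M * normLpK μ p ρ F) (hF : F ∈ LpK μ p ρ) :
    IsKbcsFun (truncExt μ T F) := by
  have hAF : ∀ k, (truncSet μ F k).indicator F ∈ LocIntBdd μ d := fun k =>
    indicator_mem_locIntBdd_of_subset_truncSet hF.1 (measurableSet_truncSet hF.1 k) subset_rfl
  have hm : SetMeasurable (truncLim μ T F) :=
    .closure_iUnion fun k => (hT.map_mem _ (hAF k)).1.measurable
  -- Completeness of `μ` makes this null set measurable.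
  have hnull : MeasurableSet {x | IsKbcs (truncLim μ T F x)}ᶜ :=
    Measure.IsComplete.out' _ (ae_iff.1 (hT.ae_isKbcs_truncLim hρ hp hq hM hF))
  refine ⟨fun x => isKbcs_truncExt x, .piecewise hnull.of_compl hm (.const 0)
    (fun x hx => truncExt_of_isKbcs hx) fun x hx => if_neg hx⟩

lemma normLpK_truncExt_le (hT : IsMonotoneOperator μ T) (hρ : IsNormFunction ρ) (hp : 0 < p)
    (hq : 0 < q) (hM : ∀ F ∈ LocIntBdd μ d, F ∈ LpK μ p ρ →
      normLpK μ q ρ (T F) ≤ M * normLpK μ p ρ F) (hF : F ∈ LpK μ p ρ) :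
    normLpK μ q ρ (truncExt μ T F) ≤ M * normLpK μ p ρ F := by
  refine (normLpK_mono hq ?_).trans (hT.normLpK_truncLim_le hρ hp hq hM hF)
  filter_upwards [hT.ae_truncExt_eq hρ hp hq hM hF] with x hx
  exact hx.le

variable [SecondCountableTopology Ω]

/-- The truncation limit may be computed along any exhaustion. -/
lemma truncLim_eq (hT : IsMonotoneOperator μ T) (hF : IsKbcsFun F) {A : ℕ → Set Ω}
    (hA : Monotone A) (hAm : ∀ k, MeasurableSet (A k)) (hA1 : ∀ x, ∃ k, x ∈ A k)
    (hAF : ∀ k, (A k).indicator F ∈ LocIntBdd μ d) :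
    ∀ᵐ x ∂μ, truncLim μ T F x = closure (⋃ k, T ((A k).indicator F) x) := by
  have hBF : ∀ k, (truncSet μ F k).indicator F ∈ LocIntBdd μ d := fun k =>
    indicator_mem_locIntBdd_of_subset_truncSet hF (measurableSet_truncSet hF k) subset_rfl
  filter_upwards [hT.closure_iUnion_subset hF hA hAm hA1 hAF hBF,
    hT.closure_iUnion_subset hF monotone_truncSet (measurableSet_truncSet hF) exists_mem_truncSet
      hBF hAF] with x h1 h2
  exact subset_antisymm h1 h2

lemma truncExt_eq_of_mem_locIntBdd (hT : IsMonotoneOperator μ T)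
    (hF : F ∈ LocIntBdd μ d) : ∀ᵐ x ∂μ, truncExt μ T F x = T F x := by
  filter_upwards [hT.ae_eq_closure_iUnion hF (monotone_truncSet (μ := μ)) (measurableSet_truncSet hF.1)
    (.of_forall exists_mem_truncSet)] with x hx
  have hx : truncLim μ T F x = T F x := hx.symm
  rw [truncExt_of_isKbcs, hx]
  rw [hx]
  exact (hT.map_mem F hF).1.isKbcs x

lemma isLinearMonotoneOn_truncExt (hT : IsMonotoneOperator μ T) (hρ : IsNormFunction ρ)
    (hp : 0 < p) (hq : 0 < q) (hM : ∀ F ∈ LocIntBdd μ d, F ∈ LpK μ p ρ →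
      normLpK μ q ρ (T F) ≤ M * normLpK μ p ρ F) :
    IsLinearMonotoneOn μ (LpK μ p ρ) (truncExt μ T) where
  map_add F hF G hG := by
    -- A common exhaustion, along which `F`, `G` and `F + G` all restrict to elements of the domain
    -- of `T`.
    set A : ℕ → Set Ω := fun k => truncSet μ F k ∩ truncSet μ G k with hAdef
    have hA : Monotone A := fun i j hij =>
      Set.inter_subset_inter (monotone_truncSet hij) (monotone_truncSet hij)
    have hAm : ∀ k, MeasurableSet (A k) := fun k =>
      (measurableSet_truncSet hF.1 k).inter (measurableSet_truncSet hG.1 k)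
    have hA1 : ∀ x, ∃ k, x ∈ A k := fun x => by
      obtain ⟨i, hi⟩ := exists_mem_truncSet (μ := μ) (F := F) x
      obtain ⟨j, hj⟩ := exists_mem_truncSet (μ := μ) (F := G) x
      exact ⟨max i j, monotone_truncSet (le_max_left i j) hi,
        monotone_truncSet (le_max_right i j) hj⟩
    have hAF : ∀ k, (A k).indicator F ∈ LocIntBdd μ d := fun k =>
      indicator_mem_locIntBdd_of_subset_truncSet hF.1 (hAm k) Set.inter_subset_left
    have hAG : ∀ k, (A k).indicator G ∈ LocIntBdd μ d := fun k =>
      indicator_mem_locIntBdd_of_subset_truncSet hG.1 (hAm k) Set.inter_subset_right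
    have hind : ∀ k, (A k).indicator (fun y => F y + G y) =
        fun y => (A k).indicator F y + (A k).indicator G y := fun k => Set.indicator_add _ _ _
    have hAFG : ∀ k, (A k).indicator (fun y => F y + G y) ∈ LocIntBdd μ d := fun k => by
      rw [hind]
      exact add_mem_locIntBdd (hAF k) (hAG k)
    have hadd : ∀ᵐ x ∂μ, ∀ k, T ((A k).indicator fun y => F y + G y) x =
        T ((A k).indicator F) x + T ((A k).indicator G) x := ae_all_iff.2 fun k => by
      rw [hind]
      exact hT.linear.map_add _ (hAF k) _ (hAG k)
    filter_upwards [hT.truncLim_eq hF.1 hA hAm hA1 hAF, hT.truncLim_eq hG.1 hA hAm hA1 hAG,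
      hT.truncLim_eq (hF.1.add hG.1) hA hAm hA1 hAFG, hadd, hT.ae_monotone hF.1 hA hAF,
      hT.ae_monotone hG.1 hA hAG, hT.ae_isKbcs_truncLim hρ hp hq hM hF,
      hT.ae_isKbcs_truncLim hρ hp hq hM hG] with x h1 h2 h3 h4 h5 h6 h7 h8
    have h9 : truncLim μ T (fun y => F y + G y) x = truncLim μ T F x + truncLim μ T G x := by
      rw [h3, Set.iUnion_congr h4, h1, h2]
      rw [h1] at h7
      rw [h2] at h8
      exact closure_iUnion_add h5 h6 h7.isCompact h8.isCompact
    rw [truncExt_of_isKbcs h7, truncExt_of_isKbcs h8, truncExt_of_isKbcs (h9 ▸ h7.add h8), h9]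
  map_smul c F hF := by
    have hAF : ∀ k, (truncSet μ F k).indicator F ∈ LocIntBdd μ d := fun k =>
      indicator_mem_locIntBdd_of_subset_truncSet hF.1 (measurableSet_truncSet hF.1 k) subset_rfl
    have hind : ∀ k, (truncSet μ F k).indicator (fun y => c • F y) =
        fun y => c • (truncSet μ F k).indicator F y := fun k =>
      Set.indicator_smul _ (fun _ => c) F
    have hAcF : ∀ k, (truncSet μ F k).indicator (fun y => c • F y) ∈ LocIntBdd μ d := fun k => by
      rw [hind]
      exact smul_mem_locIntBdd (hAF k) c
    have hsmul : ∀ᵐ x ∂μ, ∀ k, T ((truncSet μ F k).indicator fun y => c • F y) x =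
        c • T ((truncSet μ F k).indicator F) x := ae_all_iff.2 fun k => by
      rw [hind]
      exact hT.linear.map_smul c _ (hAF k)
    filter_upwards [hT.truncLim_eq (hF.1.smul c) monotone_truncSet (measurableSet_truncSet hF.1)
      exists_mem_truncSet hAcF, hsmul, hT.ae_isKbcs_truncLim hρ hp hq hM hF] with x h1 h2 h3
    have h4 : truncLim μ T (fun y => c • F y) x = c • truncLim μ T F x := by
      rw [h1, Set.iUnion_congr h2, ← Set.smul_set_iUnion, closure_smul₀]
      rfl
    rw [truncExt_of_isKbcs h3, truncExt_of_isKbcs (h4 ▸ h3.smul c), h4]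
  mono F hF G hG hFG := by
    have hAm := measurableSet_truncSet (μ := μ) hG.1
    -- As `F x ⊆ G x`, the truncation sets of `G` also bound `F` and serve as the common exhaustion.
    have hsub : ∀ k, truncSet μ G k ⊆ truncSet μ F k := fun k x hx =>
      ⟨hx.1, (radius_mono (hG.1.isKbcs x) (hFG x)).trans hx.2⟩
    have hAF : ∀ k, (truncSet μ G k).indicator F ∈ LocIntBdd μ d := fun k =>
      indicator_mem_locIntBdd_of_subset_truncSet hF.1 (hAm k) (hsub k)
    have hAG : ∀ k, (truncSet μ G k).indicator G ∈ LocIntBdd μ d := fun k =>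
      indicator_mem_locIntBdd_of_subset_truncSet hG.1 (hAm k) subset_rfl
    have hle : ∀ᵐ x ∂μ, ∀ k, T ((truncSet μ G k).indicator F) x ⊆
        T ((truncSet μ G k).indicator G) x := ae_all_iff.2 fun k =>
      hT.linear.mono _ (hAF k) _ (hAG k) fun x => by
        by_cases hx : x ∈ truncSet μ G k
        · simpa [hx] using hFG x
        · simp [hx]
    filter_upwards [hT.truncLim_eq hF.1 monotone_truncSet hAm exists_mem_truncSet hAF, hle,
      hT.ae_truncExt_eq hρ hp hq hM hF, hT.ae_truncExt_eq hρ hp hq hM hG] with x h1 h2 h3 h4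
    rw [h3, h4, h1]
    exact closure_mono (Set.iUnion_mono h2)

end IsMonotoneOperator

end Extension

end ConvexSetValued

theorem theorem4p1 {n d : ℕ} (Ω : Set (EuclideanSpace ℝ (Fin n))) [MeasurableSpace Ω]
    (μ : Measure Ω) [SigmaFinite μ] [μ.IsComplete]
    (p₀ p₁ q₀ q₁ : ℝ) (hp₀ : 1 ≤ p₀) (hp₁ : 1 ≤ p₁) (hq₀ : 1 ≤ q₀) (hq₁ : 1 ≤ q₁)
    (ρ₀ ρ₁ : Ω → EuclideanSpace ℝ (Fin d) → ℝ)
    (hρ₀ : IsNormFunction ρ₀) (hρ₁ : IsNormFunction ρ₁)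
    (T : (Ω → Set (EuclideanSpace ℝ (Fin d))) → Ω → Set (EuclideanSpace ℝ (Fin d)))
    (hTX : ∀ F ∈ LocIntBdd μ d, T F ∈ LocIntBdd μ d)
    (hT : IsLinearMonotoneOn μ (LocIntBdd μ d) T)
    (M₀ M₁ : ℝ≥0)
    (hM₀ : ∀ F ∈ LocIntBdd μ d, F ∈ LpK μ p₀ ρ₀ →
      normLpK μ q₀ ρ₀ (T F) ≤ M₀ * normLpK μ p₀ ρ₀ F)
    (hM₁ : ∀ F ∈ LocIntBdd μ d, F ∈ LpK μ p₁ ρ₁ →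
      normLpK μ q₁ ρ₁ (T F) ≤ M₁ * normLpK μ p₁ ρ₁ F)
    (hbdd : ∀ (A : Set Ω) (S : Set (EuclideanSpace ℝ (Fin d))), MeasurableSet A → IsKbcs S →
      chi A S ∈ LocIntBdd μ d →
      (∃ C : ℝ≥0, ∀ x, supOn (ρ₀ x) (chi A S x) ≤ C ∧ supOn (ρ₁ x) (chi A S x) ≤ C) →
      ∃ C : ℝ≥0, ∀ᵐ x ∂μ, supOn (ρ₀ x) (T (chi A S) x) ≤ C ∧ supOn (ρ₁ x) (T (chi A S) x) ≤ C)
    (θ : ℝ) (hθ₀ : 0 < θ) (hθ₁ : θ < 1) (p q : ℝ)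
    (hp : 1 / p = (1 - θ) / p₀ + θ / p₁) (hq : 1 / q = (1 - θ) / q₀ + θ / q₁) :
    ∃ M : ℝ≥0,
      -- the bound on all of `X ∩ L^p_𝒦(Ω, ρ)`, in particular for simple functions
      (∀ F ∈ LocIntBdd μ d, F ∈ LpK μ p (interpNorm θ ρ₀ ρ₁) →
        normLpK μ q (interpNorm θ ρ₀ ρ₁) (T F) ≤ M * normLpK μ p (interpNorm θ ρ₀ ρ₁) F) ∧
      -- the bounded extension to all of `L^p_𝒦(Ω, ρ)`
      ∃ T' : (Ω → Set (EuclideanSpace ℝ (Fin d))) → Ω → Set (EuclideanSpace ℝ (Fin d)),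
        IsLinearMonotoneOn μ (LpK μ p (interpNorm θ ρ₀ ρ₁)) T' ∧
        (∀ F ∈ LocIntBdd μ d, F ∈ LpK μ p (interpNorm θ ρ₀ ρ₁) → ∀ᵐ x ∂μ, T' F x = T F x) ∧
        ∀ F ∈ LpK μ p (interpNorm θ ρ₀ ρ₁),
          T' F ∈ LpK μ q (interpNorm θ ρ₀ ρ₁) ∧
          normLpK μ q (interpNorm θ ρ₀ ρ₁) (T' F) ≤ M * normLpK μ p (interpNorm θ ρ₀ ρ₁) F := by
  have hp₀' : 0 < p₀ := by linarith
  have hp₁' : 0 < p₁ := by linarith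
  have hq₀' : 0 < q₀ := by linarith
  have hq₁' : 0 < q₁ := by linarith
  have hθ' : 0 < 1 - θ := by linarith
  have hp0 : 0 < p := one_div_pos.1 (by rw [hp]; positivity)
  have hq0 : 0 < q := one_div_pos.1 (by rw [hq]; positivity)
  have hρ := isNormFunction_interpNorm hρ₀ hρ₁ hθ₀ hθ₁
  have hTm := isMonotoneOperator_of_bound hρ₀ hp₀' hq₀' hTX hT hM₀
  obtain ⟨C, hC⟩ := exists_isSplittingConst d hθ₀ hθ₁
  have hM : ∀ F ∈ LocIntBdd μ d, F ∈ LpK μ p (interpNorm θ ρ₀ ρ₁) →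
      normLpK μ q (interpNorm θ ρ₀ ρ₁) (T F) ≤
        (C * (M₀ ^ (1 - θ) * M₁ ^ θ) : ℝ≥0) * normLpK μ p (interpNorm θ ρ₀ ρ₁) F :=
    fun F hFX hF => normLpK_le_of_mem_locIntBdd hC hp₀' hp₁' hq₀' hq₁' hp0 hq0 hρ₀ hρ₁ hTm hM₀ hM₁
      hθ₀ hθ₁ hp hq hFX hF
  refine ⟨C * (M₀ ^ (1 - θ) * M₁ ^ θ), hM, truncExt μ T,
    hTm.isLinearMonotoneOn_truncExt hρ hp0 hq0 hM,
    fun F hFX _ => hTm.truncExt_eq_of_mem_locIntBdd hFX, fun F hF => ?_⟩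
  have hle := hTm.normLpK_truncExt_le hρ hp0 hq0 hM hF
  exact ⟨⟨hTm.isKbcsFun_truncExt hρ hp0 hq0 hM hF,
    hle.trans_lt (ENNReal.mul_lt_top ENNReal.coe_lt_top hF.2)⟩, hle⟩
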